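/- Let $(M,g)$ be a smooth Lorentzian manifold of dimension $n\ge 2$ (signature $(-,+,\dots,+)$), let $\gamma:D\to M$ be a null geodesic defined on an open interval $D\subseteq\mathbb R$ (so $\dot\gamma$ is nonzero and null), let $J\subseteq D$ be an interval such that $\gamma' = \gamma|_J$ is free of conjugate points (no two distinct parameters $s,t\in J$ admit a Jacobi field along $\gamma$ that is not identically zero and vanishes at both $s$ and $t$), and let $t_0\in J$. Then there is a smooth chart $\psi=(u,v,x^1,\dots,x^{n-2})$ of $M$ on an open neighbourhood $U$ of the point $\gamma(t_0)$, with $\psi(\gamma(t_0))=0$ ("null coordinates"), such that on $U$ $$g = 2\,du\,dv+H\,du^{2}+2A_a\,dx^a\,du+g_{ab}\,dx^a\,dx^b ,\qquad a,b\in\{1,\dots,n-2\},$$ where $H$, $A_a$ and $g_{ab}$ are smooth functions of the coordinates and the matrix $(g_{ab})$ is positive definite. Moreover, in these coordinates $\gamma$ is the integral curve of $\partial_v$ through the origin: $\dot\gamma(t)=\partial_v|_{\gamma(t)}$ for all $t\in D$ such that $\gamma$ maps the closed interval between $t_0$ and $t$ into $U$. -/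

import Mathlib

open Bundle Set Module
open scoped Manifold ContDiff

noncomputable section

/-- A smooth Lorentzian metric of signature `(-,+,…,+)` on the smooth `n`-manifold `M`. -/
structure LorentzianMetric (n : ℕ) (M : Type*) [TopologicalSpace M]
    [ChartedSpace (EuclideanSpace ℝ (Fin n)) M] [IsManifold (𝓡 n) ∞ M] where
  /-- The bilinear form on each tangent space. -/
  inner (p : M) : TangentSpace (𝓡 n) p →L[ℝ] TangentSpace (𝓡 n) p →L[ℝ] ℝ
  symm (p : M) (X Y : TangentSpace (𝓡 n) p) : inner p X Y = inner p Y X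
  /-- Every tangent space has an orthonormal basis with exactly one timelike vector. -/
  signature (p : M) : ∃ (b : Basis (Fin n) ℝ (TangentSpace (𝓡 n) p)) (i₀ : Fin n),
    ∀ i j, inner p (b i) (b j) = if i = j then (if i = i₀ then -1 else 1) else 0
  contMDiff : ContMDiff (𝓡 n)
    ((𝓡 n).prod 𝓘(ℝ, EuclideanSpace ℝ (Fin n) →L[ℝ] EuclideanSpace ℝ (Fin n) →L[ℝ] ℝ)) ∞
    (fun p ↦ TotalSpace.mk'
      (EuclideanSpace ℝ (Fin n) →L[ℝ] EuclideanSpace ℝ (Fin n) →L[ℝ] ℝ) p (inner p))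

section Charts

variable {n : ℕ} {M : Type*} [TopologicalSpace M] [ChartedSpace (EuclideanSpace ℝ (Fin n)) M]

/-- `φ` is a smooth coordinate chart of `M`: a member of the maximal smooth atlas. -/
def IsSmoothChart (φ : OpenPartialHomeomorph M (EuclideanSpace ℝ (Fin n))) : Prop :=
  φ ∈ IsManifold.maximalAtlas (𝓡 n) ∞ M

/-- The value `dxⁱ(X)` at `p` of the differential of the `i`-th coordinate function of `φ`; this is
also the `i`-th component of the tangent vector `X` in the chart `φ`. -/
def coordDiff (φ : OpenPartialHomeomorph M (EuclideanSpace ℝ (Fin n))) (i : Fin n) (p : M)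
    (X : TangentSpace (𝓡 n) p) : ℝ :=
  (show EuclideanSpace ℝ (Fin n) from mfderiv (𝓡 n) (𝓡 n) φ p X) i

/-- The coordinate vector field `∂/∂xⁱ` of the chart `φ` (meaningful on `φ.source`). -/
def coordField (φ : OpenPartialHomeomorph M (EuclideanSpace ℝ (Fin n))) (i : Fin n) (p : M) :
    TangentSpace (𝓡 n) p :=
  (mfderiv (𝓡 n) (𝓡 n) φ p).inverse (EuclideanSpace.single i (1 : ℝ))

/-- The partial derivative `∂f/∂xⁱ` of a function on coordinate space. -/
def partialDeriv (i : Fin n) (f : EuclideanSpace ℝ (Fin n) → ℝ) (y : EuclideanSpace ℝ (Fin n)) :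
    ℝ :=
  fderiv ℝ f y (EuclideanSpace.single i (1 : ℝ))

variable [IsManifold (𝓡 n) ∞ M]

/-- The matrix `(g_ij)` of the metric in the chart `φ`, as a function of the coordinates
`y ∈ φ.target`. -/
def LorentzianMetric.gram (g : LorentzianMetric n M)
    (φ : OpenPartialHomeomorph M (EuclideanSpace ℝ (Fin n))) (y : EuclideanSpace ℝ (Fin n)) :
    Matrix (Fin n) (Fin n) ℝ :=
  Matrix.of fun i j ↦ g.inner (φ.symm y) (coordField φ i (φ.symm y)) (coordField φ j (φ.symm y))

/-- The Christoffel symbols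
`Γᵏ_ij = ½ ∑ₗ gᵏˡ (∂_i g_jl + ∂_j g_il - ∂_l g_ij)` of the Levi-Civita connection. -/
def LorentzianMetric.christoffel (g : LorentzianMetric n M)
    (φ : OpenPartialHomeomorph M (EuclideanSpace ℝ (Fin n))) (k i j : Fin n)
    (y : EuclideanSpace ℝ (Fin n)) : ℝ :=
  (1 / 2 : ℝ) * ∑ l, (g.gram φ y)⁻¹ k l *
    (partialDeriv i (fun z ↦ g.gram φ z j l) y + partialDeriv j (fun z ↦ g.gram φ z i l) y
      - partialDeriv l (fun z ↦ g.gram φ z i j) y)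

/-- The components `Rˡ_ijk` of the curvature tensor, defined by `R(∂_i, ∂_j) ∂_k = ∑ₗ Rˡ_ijk ∂_l`
where `R(X, Y) Z = ∇_X ∇_Y Z - ∇_Y ∇_X Z - ∇_[X,Y] Z`. -/
def LorentzianMetric.curvature (g : LorentzianMetric n M)
    (φ : OpenPartialHomeomorph M (EuclideanSpace ℝ (Fin n))) (l i j k : Fin n)
    (y : EuclideanSpace ℝ (Fin n)) : ℝ :=
  partialDeriv i (g.christoffel φ l j k) y - partialDeriv j (g.christoffel φ l i k) y
    + ∑ m, (g.christoffel φ l i m y * g.christoffel φ m j k y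
      - g.christoffel φ l j m y * g.christoffel φ m i k y)

/-- The components in the chart `φ` of the covariant derivative along the curve `γ` of the vector
field along `γ` with components `W`: `(D_t W)ᵏ = dWᵏ/dt + ∑ Γᵏ_ij (dγⁱ/dt) Wʲ`. -/
def LorentzianMetric.covDerivAlong (g : LorentzianMetric n M)
    (φ : OpenPartialHomeomorph M (EuclideanSpace ℝ (Fin n))) (γ : ℝ → M)
    (W : Fin n → ℝ → ℝ) (k : Fin n) (t : ℝ) : ℝ :=
  deriv (W k) t
    + ∑ i, ∑ j, g.christoffel φ k i j (φ (γ t)) * deriv (fun s ↦ φ (γ s) i) t * W j t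

/-- `γ` is a geodesic on the open interval `D`: a smooth curve with `D_t γ̇ = 0` in every chart. -/
structure LorentzianMetric.IsGeodesicOn (g : LorentzianMetric n M) (γ : ℝ → M) (D : Set ℝ) :
    Prop where
  isOpen : IsOpen D
  ordConnected : D.OrdConnected
  contMDiffOn : ContMDiffOn 𝓘(ℝ, ℝ) (𝓡 n) ∞ γ D
  eq : ∀ φ : OpenPartialHomeomorph M (EuclideanSpace ℝ (Fin n)), IsSmoothChart φ →
    ∀ t ∈ D, γ t ∈ φ.source → ∀ k,
      g.covDerivAlong φ γ (fun i ↦ deriv fun s ↦ φ (γ s) i) k t = 0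

/-- The velocity vector `γ̇(t)`. -/
def velocity (γ : ℝ → M) (t : ℝ) : TangentSpace (𝓡 n) (γ t) :=
  mfderiv 𝓘(ℝ, ℝ) (𝓡 n) γ t (1 : ℝ)

/-- `γ` is a null geodesic on the open interval `D`: a geodesic whose velocity is a (nonzero) null
vector everywhere. -/
structure LorentzianMetric.IsNullGeodesicOn (g : LorentzianMetric n M) (γ : ℝ → M) (D : Set ℝ) :
    Prop extends g.IsGeodesicOn γ D where
  velocity_ne_zero : ∀ t ∈ D, velocity (n := n) γ t ≠ 0
  null : ∀ t ∈ D, g.inner (γ t) (velocity γ t) (velocity γ t) = 0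

/-- `V` is a Jacobi field along `γ` on `D`: a smooth vector field along `γ` satisfying
`D_t D_t V + R(V, γ̇) γ̇ = 0` in every chart. -/
structure LorentzianMetric.IsJacobiFieldOn (g : LorentzianMetric n M) (γ : ℝ → M) (D : Set ℝ)
    (V : ∀ t, TangentSpace (𝓡 n) (γ t)) : Prop where
  contDiffOn : ∀ φ : OpenPartialHomeomorph M (EuclideanSpace ℝ (Fin n)), IsSmoothChart φ →
    ∀ i, ContDiffOn ℝ ∞ (fun t ↦ coordDiff φ i (γ t) (V t)) (D ∩ γ ⁻¹' φ.source)
  eq : ∀ φ : OpenPartialHomeomorph M (EuclideanSpace ℝ (Fin n)), IsSmoothChart φ →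
    ∀ t ∈ D, γ t ∈ φ.source → ∀ l,
      g.covDerivAlong φ γ
          (g.covDerivAlong φ γ fun i s ↦ coordDiff φ i (γ s) (V s)) l t
        + ∑ i, ∑ j, ∑ k, g.curvature φ l i j k (φ (γ t)) * coordDiff φ i (γ t) (V t)
            * deriv (fun s ↦ φ (γ s) j) t * deriv (fun s ↦ φ (γ s) k) t = 0

/-- The parameters `s ≠ t` in `D` are conjugate along the geodesic `γ : D → M`: some Jacobi field
along `γ` that does not vanish identically vanishes at both. -/
def LorentzianMetric.AreConjugateAlong (g : LorentzianMetric n M) (γ : ℝ → M) (D : Set ℝ)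
    (s t : ℝ) : Prop :=
  s ≠ t ∧ ∃ V : ∀ r, TangentSpace (𝓡 n) (γ r),
    g.IsJacobiFieldOn γ D V ∧ V s = 0 ∧ V t = 0 ∧ ∃ r ∈ D, V r ≠ 0

/-- The portion of the geodesic `γ : D → M` with parameter interval `J ⊆ D` is free of conjugate
points. -/
structure LorentzianMetric.IsConjugatePointFreePortion (g : LorentzianMetric n M) (γ : ℝ → M)
    (D J : Set ℝ) : Prop where
  subset : J ⊆ D
  ordConnected : J.OrdConnected
  not_conjugate : ∀ s ∈ J, ∀ t ∈ J, ¬ g.AreConjugateAlong γ D s t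

end Charts

section NullCoordinates

variable {m : ℕ} {M : Type*} [TopologicalSpace M]
  [ChartedSpace (EuclideanSpace ℝ (Fin (m + 2))) M] [IsManifold (𝓡 (m + 2)) ∞ M]

/-- The index of the coordinate `xᵃ` when the coordinates are ordered as `(u, v, x¹, …, xᵐ)`. -/
def xIdx (a : Fin m) : Fin (m + 2) := a.succ.succ

/-- `ψ` is a chart of null coordinates `(u, v, x¹, …, xᵐ)`, `m = n - 2`: on its domain
`g = 2 du dv + H du² + 2 A_a dxᵃ du + h_ab dxᵃ dxᵇ` for smooth functions `H`, `A_a`, `h_ab` of the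
coordinates, with `(h_ab)` positive definite.  Products of one-forms are symmetrized, so that
`2 du dv = du ⊗ dv + dv ⊗ du`. -/
def LorentzianMetric.IsNullCoordinateChart (g : LorentzianMetric (m + 2) M)
    (ψ : OpenPartialHomeomorph M (EuclideanSpace ℝ (Fin (m + 2)))) : Prop :=
  IsSmoothChart ψ ∧
  ∃ (H : EuclideanSpace ℝ (Fin (m + 2)) → ℝ) (A : Fin m → EuclideanSpace ℝ (Fin (m + 2)) → ℝ)
    (h : EuclideanSpace ℝ (Fin (m + 2)) → Matrix (Fin m) (Fin m) ℝ),
    ContDiffOn ℝ ∞ H ψ.target ∧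
    (∀ a, ContDiffOn ℝ ∞ (A a) ψ.target) ∧
    (∀ a b, ContDiffOn ℝ ∞ (fun y ↦ h y a b) ψ.target) ∧
    (∀ y ∈ ψ.target, (h y).PosDef) ∧
    ∀ p ∈ ψ.source, ∀ X Y : TangentSpace (𝓡 (m + 2)) p,
      g.inner p X Y =
        (coordDiff ψ 0 p X * coordDiff ψ 1 p Y + coordDiff ψ 1 p X * coordDiff ψ 0 p Y)
        + H (ψ p) * coordDiff ψ 0 p X * coordDiff ψ 0 p Y
        + ∑ a, A a (ψ p) * (coordDiff ψ (xIdx a) p X * coordDiff ψ 0 p Y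
            + coordDiff ψ 0 p X * coordDiff ψ (xIdx a) p Y)
        + ∑ a, ∑ b, h (ψ p) a b * coordDiff ψ (xIdx a) p X * coordDiff ψ (xIdx b) p Y

end NullCoordinates

end

/-!
In the coordinates of any chart, geodesics are the projections of the solutions of the Hamiltonian
system with Hamiltonian `½ g⁻¹(p, p)` on position-momentum pairs. Choose linear coordinates
`(u, v, x)` near `γ(t₀)` in which `γ̇(t₀)` is `∂_v` and has momentum `du`, and extend `γ̇(t₀)` along
the hyperplane `v = 0` to a field of null vectors whose momenta restrict to `du` on the hyperplane.
Issue a geodesic with this initial velocity from each point of the hyperplane and let `v` now be its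
parameter; by the inverse function theorem `(u, v, x)` is a chart near `γ(t₀)`. Along each of these
geodesics, the pairing of the momentum with a variation of the family changes at the rate of half
the corresponding derivative of the energy `g(∂_v, ∂_v)`, which vanishes identically. So
`g(∂_v, ·) = du` holds on the whole chart and not only on the hyperplane. This is the asserted form
of the metric; `(g_ab)` is positive definite because `∂_v` is null and the `∂_a` span a complement
of it in its orthogonal space.
-/

set_option maxSynthPendingDepth 3

noncomputable section

open Filter Topology

section Superposition

universe u

variable {K : Type*} [TopologicalSpace K] [CompactSpace K]

/-- Pointwise application `(A, h) ↦ (k ↦ A k (h k))`, as a continuous bilinear map on spaces of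
continuous functions: the derivative of `α ↦ f ∘ α` is pointwise application of `f' ∘ α`. -/
def pointwiseApply (K : Type*) [TopologicalSpace K] [CompactSpace K]
    (E F : Type*) [NormedAddCommGroup E] [NormedSpace ℝ E]
    [NormedAddCommGroup F] [NormedSpace ℝ F] :
    C(K, E →L[ℝ] F) →L[ℝ] C(K, E) →L[ℝ] C(K, F) :=
  LinearMap.mkContinuous₂
    (LinearMap.mk₂ ℝ (fun (A : C(K, E →L[ℝ] F)) (h : C(K, E)) ↦
        (⟨fun k ↦ A k (h k), by fun_prop⟩ : C(K, F)))
      (fun _ _ _ ↦ by ext; simp) (fun _ _ _ ↦ by ext; simp)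
      (fun _ _ _ ↦ by ext; simp) (fun _ _ _ ↦ by ext; simp)) 1 (by
    intro A h
    rw [ContinuousMap.norm_le _ (by positivity)]
    intro k
    simp only [LinearMap.mk₂_apply, ContinuousMap.coe_mk, one_mul]
    exact (A k).le_of_opNorm_le_of_le (A.norm_coe_le_norm k) (h.norm_coe_le_norm k))

@[simp] lemma pointwiseApply_apply {E F : Type*} [NormedAddCommGroup E]
    [NormedSpace ℝ E] [NormedAddCommGroup F] [NormedSpace ℝ F]
    (A : C(K, E →L[ℝ] F)) (h : C(K, E)) (k : K) : pointwiseApply K E F A h k = A k (h k) := rfl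

lemma hasFDerivAt_continuousMap_comp {E F : Type*} [NormedAddCommGroup E] [NormedSpace ℝ E]
    [NormedAddCommGroup F] [NormedSpace ℝ F] {f : E → F} {f' : E → E →L[ℝ] F}
    (hf : ∀ x, HasFDerivAt f (f' x) x) (hf' : Continuous f') (hfc : Continuous f) (α : C(K, E)) :
    HasFDerivAt (fun β : C(K, E) ↦ ContinuousMap.comp ⟨f, hfc⟩ β)
      (pointwiseApply K E F (ContinuousMap.comp ⟨f', hf'⟩ α)) α := by
  rw [hasFDerivAt_iff_isLittleO_nhds_zero, Asymptotics.isLittleO_iff]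
  intro c hc
  obtain ⟨δ, hδ, hball⟩ : ∃ δ > 0, ∀ β : C(K, E), dist β α < δ →
      dist (ContinuousMap.comp ⟨f', hf'⟩ β) (ContinuousMap.comp ⟨f', hf'⟩ α) < c :=
    Metric.continuous_iff.1 (ContinuousMap.continuous_postcomp _) α c hc
  filter_upwards [Metric.ball_mem_nhds (0 : C(K, E)) hδ] with h hh
  rw [ContinuousMap.norm_le _ (by positivity)]
  intro k
  have hsegment : ∀ y ∈ segment ℝ (α k) (α k + h k), ‖f' y - f' (α k)‖ ≤ c := by
    rw [segment_eq_image']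
    rintro _ ⟨s, hs, rfl⟩
    have hdist : dist (α + s • h) α < δ := by
      rw [dist_eq_norm, add_sub_cancel_left, norm_smul, Real.norm_of_nonneg hs.1]
      exact (mul_le_of_le_one_left (norm_nonneg _) hs.2).trans_lt (mem_ball_zero_iff.1 hh)
    simpa [dist_eq_norm] using
      (ContinuousMap.dist_apply_le_dist (f := ContinuousMap.comp ⟨f', hf'⟩ (α + s • h))
        (g := ContinuousMap.comp ⟨f', hf'⟩ α) k).trans (hball _ hdist).le
  calc _ = ‖f (α k + h k) - f (α k) - f' (α k) (α k + h k - α k)‖ := by simp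
    _ ≤ c * ‖α k + h k - α k‖ :=
      (convex_segment (α k) (α k + h k)).norm_image_sub_le_of_norm_hasFDerivWithin_le'
        (fun y _ ↦ (hf y).hasFDerivWithinAt) hsegment (left_mem_segment ℝ _ _)
        (right_mem_segment ℝ _ _)
    _ ≤ c * ‖h‖ := by
      rw [add_sub_cancel_left]
      exact mul_le_mul_of_nonneg_left (h.norm_coe_le_norm k) hc.le

lemma contDiff_nat_continuousMap_comp {E : Type u} [NormedAddCommGroup E] [NormedSpace ℝ E]
    (n : ℕ) {F : Type u} [NormedAddCommGroup F] [NormedSpace ℝ F] {f : E → F}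
    (hf : ContDiff ℝ n f) :
    ContDiff ℝ n (fun β : C(K, E) ↦ ContinuousMap.comp ⟨f, hf.continuous⟩ β) := by
  induction n generalizing F with
  | zero => exact contDiff_zero.2 (ContinuousMap.continuous_postcomp _)
  | succ n ih =>
    have hf' : ContDiff ℝ n (fderiv ℝ f) := hf.fderiv_right (by norm_cast)
    push_cast
    refine contDiff_succ_iff_hasFDerivAt.2 ⟨_, (pointwiseApply K E F).contDiff.comp (ih hf'),
      hasFDerivAt_continuousMap_comp (fun x ↦ ?_) hf'.continuous hf.continuous⟩
    exact (hf.differentiable (by simp) x).hasFDerivAt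

lemma contDiff_continuousMap_comp {E F : Type u} [NormedAddCommGroup E] [NormedSpace ℝ E]
    [NormedAddCommGroup F] [NormedSpace ℝ F] {f : E → F} (hf : ContDiff ℝ ∞ f) :
    ContDiff ℝ ∞ (fun β : C(K, E) ↦ ContinuousMap.comp ⟨f, hf.continuous⟩ β) :=
  contDiff_infty.2 fun n ↦ contDiff_nat_continuousMap_comp n (hf.of_le (by exact_mod_cast le_top))

end Superposition

section SmoothMaps

variable {E F : Type*} [NormedAddCommGroup E] [NormedSpace ℝ E]
  [NormedAddCommGroup F] [NormedSpace ℝ F] {f : E → F} {s : Set E} {a : E}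

lemma exists_openPartialHomeomorph_of_contDiffOn [CompleteSpace E] (hs : IsOpen s)
    (hf : ContDiffOn ℝ ∞ f s) (ha : a ∈ s) (f' : E ≃L[ℝ] F)
    (hf' : HasFDerivAt f (f' : E →L[ℝ] F) a) :
    ∃ e : OpenPartialHomeomorph E F, a ∈ e.source ∧ e.source ⊆ s ∧ (∀ x, e x = f x) ∧
      ContDiffOn ℝ ∞ e.symm e.target := by
  have hfa : ContDiffAt ℝ ∞ f a := hf.contDiffAt (hs.mem_nhds ha)
  let t : Set E := s ∩ fderiv ℝ f ⁻¹' range ((↑) : (E ≃L[ℝ] F) → E →L[ℝ] F)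
  have ht : IsOpen t :=
    (hf.continuousOn_fderiv_of_isOpen hs (by simp)).isOpen_inter_preimage hs
      ContinuousLinearEquiv.isOpen
  let e := (hfa.toOpenPartialHomeomorph f hf' (by simp)).restrOpen t ht
  refine ⟨e, ⟨hfa.mem_toOpenPartialHomeomorph_source hf' (by simp), ha, f', hf'.fderiv.symm⟩,
    fun x hx ↦ hx.2.1, fun x ↦ rfl, fun y hy ↦ ?_⟩
  obtain ⟨-, hys, f'', hf''⟩ := e.map_target hy
  have hfy : ContDiffAt ℝ ∞ f (e.symm y) := hf.contDiffAt (hs.mem_nhds hys)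
  refine (e.contDiffAt_symm (f₀' := f'') hy ?_ hfy).contDiffWithinAt
  exact hf'' ▸ (hfy.differentiableAt (by simp)).hasFDerivAt

lemma exists_contDiff_eventuallyEq [HasContDiffBump E] (hs : IsOpen s)
    (hf : ContDiffOn ℝ ∞ f s) (ha : a ∈ s) : ∃ g : E → F, ContDiff ℝ ∞ g ∧ g =ᶠ[𝓝 a] f := by
  obtain ⟨r, hr, hrs⟩ := Metric.isOpen_iff.1 hs a ha
  let χ : ContDiffBump a := ⟨r / 4, r / 2, by positivity, by linarith⟩
  have hsub : Metric.closedBall a (r / 2) ⊆ s :=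
    (Metric.closedBall_subset_ball (by linarith)).trans hrs
  refine ⟨fun x ↦ χ x • f x, contDiff_iff_contDiffAt.2 fun x ↦ ?_, ?_⟩
  · by_cases hx : x ∈ Metric.closedBall a (r / 2)
    · exact χ.contDiffAt.smul (hf.contDiffAt (hs.mem_nhds (hsub hx)))
    · have : (fun x ↦ χ x • f x) =ᶠ[𝓝 x] fun _ ↦ 0 := by
        filter_upwards [Metric.isClosed_closedBall.isOpen_compl.mem_nhds hx] with y hy
        rw [χ.zero_of_le_dist (not_le.1 (Metric.mem_closedBall.not.1 hy)).le, zero_smul]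
      exact contDiffAt_const.congr_of_eventuallyEq this
  · filter_upwards [χ.eventuallyEq_one] with x hx
    simp [hx]

end SmoothMaps

section Flow

universe u

variable {E : Type u} [NormedAddCommGroup E] [NormedSpace ℝ E]

/-- The primitive vanishing at `0` of a continuous function on `[-1, 1]`, as a continuous linear
map. -/
def primitive (E : Type*) [NormedAddCommGroup E] [NormedSpace ℝ E] :
    C(Icc (-1 : ℝ) 1, E) →L[ℝ] C(Icc (-1 : ℝ) 1, E) :=
  have hcont (h : C(Icc (-1 : ℝ) 1, E)) :
      Continuous fun τ ↦ h (projIcc (-1) 1 (by norm_num) τ) := h.continuous.comp continuous_projIcc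
  LinearMap.mkContinuous
    { toFun := fun h ↦ ⟨fun s ↦ ∫ τ in (0 : ℝ)..s, h (projIcc (-1) 1 (by norm_num) τ),
        (intervalIntegral.continuous_primitive
          (fun _ _ ↦ (hcont h).intervalIntegrable _ _) 0).comp continuous_subtype_val⟩
      map_add' := fun h k ↦ by
        ext s
        exact intervalIntegral.integral_add ((hcont h).intervalIntegrable _ _)
          ((hcont k).intervalIntegrable _ _)
      map_smul' := fun c h ↦ by
        ext s
        exact intervalIntegral.integral_smul _ _ } 1 (by
    intro h
    rw [ContinuousMap.norm_le _ (by positivity)]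
    intro s
    refine (intervalIntegral.norm_integral_le_of_norm_le_const
      (fun τ _ ↦ h.norm_coe_le_norm _)).trans ?_
    rw [one_mul, sub_zero]
    exact mul_le_of_le_one_right (norm_nonneg _) (abs_le.2 s.2))

lemma primitive_apply {E : Type*} [NormedAddCommGroup E] [NormedSpace ℝ E]
    (h : C(Icc (-1 : ℝ) 1, E)) (s : Icc (-1 : ℝ) 1) :
    primitive E h s = ∫ τ in (0 : ℝ)..s, h (projIcc (-1) 1 (by norm_num) τ) := rfl

/-- `α` is the solution `s ↦ x(sT)`, `-1 ≤ s ≤ 1`, of the initial value problem `x' = f(x)`,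
`x(0) = x₀`, with `z = (T, x₀)`, in integral form. Rescaling time to `[-1, 1]` makes the elapsed
time `T` a parameter on the same footing as the initial value. -/
def IsRescaledSolution (f : E → E) (z : ℝ × E) (α : C(Icc (-1 : ℝ) 1, E)) : Prop :=
  ∀ s : Icc (-1 : ℝ) 1, α s = z.2 + z.1 • ∫ τ in (0 : ℝ)..s, f (α (projIcc (-1) 1 (by norm_num) τ))

/-- The map whose value at `(z, α)` is `(z, 0)` precisely when `α` is a rescaled solution with
parameters `z`. -/
def flowEquation (f : E → E) (hf : Continuous f)
    (z : (ℝ × E) × C(Icc (-1 : ℝ) 1, E)) : (ℝ × E) × C(Icc (-1 : ℝ) 1, E) :=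
  (z.1, z.2 - ContinuousMap.const _ z.1.2 - z.1.1 • primitive E (ContinuousMap.comp ⟨f, hf⟩ z.2))

lemma flowEquation_eq_iff {f : E → E} (hf : Continuous f) {z : ℝ × E}
    {α : C(Icc (-1 : ℝ) 1, E)} :
    flowEquation f hf (z, α) = (z, 0) ↔ IsRescaledSolution f z α := by
  simp [flowEquation, IsRescaledSolution, ContinuousMap.ext_iff, primitive_apply, sub_sub,
    sub_eq_zero]

lemma isRescaledSolution_const (f : E → E) (x : E) :
    IsRescaledSolution f (0, x) (ContinuousMap.const _ x) :=
  fun s ↦ by simp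

lemma contDiff_flowEquation {f : E → E} (hf : ContDiff ℝ ∞ f) :
    ContDiff ℝ ∞ (flowEquation f hf.continuous) := by
  have hconst : ContDiff ℝ ∞ fun x : E ↦ ContinuousMap.const (Icc (-1 : ℝ) 1) x :=
    (ContinuousLinearMap.const ℝ (Icc (-1 : ℝ) 1) : E →L[ℝ] _).contDiff
  exact contDiff_fst.prodMk ((contDiff_snd.sub (hconst.comp contDiff_fst.snd)).sub
    (contDiff_fst.fst.smul
      ((primitive E).contDiff.comp ((contDiff_continuousMap_comp hf).comp contDiff_snd))))

-- At elapsed time `0` the derivative is block triangular with identity diagonal blocks.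
lemma exists_hasFDerivAt_flowEquation {f : E → E} (hf : ContDiff ℝ ∞ f) (x₀ : E) :
    ∃ e : ((ℝ × E) × C(Icc (-1 : ℝ) 1, E)) ≃L[ℝ] ((ℝ × E) × C(Icc (-1 : ℝ) 1, E)),
      HasFDerivAt (flowEquation f hf.continuous)
        (e : ((ℝ × E) × C(Icc (-1 : ℝ) 1, E)) →L[ℝ] _) ((0, x₀), ContinuousMap.const _ x₀) := by
  let I := Icc (-1 : ℝ) 1
  let c : E →L[ℝ] C(I, E) := ContinuousLinearMap.const ℝ _
  let N : C(I, E) → C(I, E) := fun β ↦ primitive E (ContinuousMap.comp ⟨f, hf.continuous⟩ β)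
  let A : ℝ × E →L[ℝ] C(I, E) :=
    -(c ∘L ContinuousLinearMap.snd ℝ ℝ E) - (ContinuousLinearMap.fst ℝ ℝ E).smulRight (N (c x₀))
  refine ⟨(ContinuousLinearEquiv.refl ℝ (ℝ × E)).skewProd (ContinuousLinearEquiv.refl ℝ _) A, ?_⟩
  have hN : HasFDerivAt N (fderiv ℝ N (c x₀)) (c x₀) :=
    (((primitive E).contDiff.comp (contDiff_continuousMap_comp hf)).differentiable
      (by simp) _).hasFDerivAt
  have hT : HasFDerivAt (fun z : (ℝ × E) × C(I, E) ↦ z.1.1)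
      (ContinuousLinearMap.fst ℝ ℝ E ∘L ContinuousLinearMap.fst ℝ (ℝ × E) _) ((0, x₀), c x₀) :=
    hasFDerivAt_fst.fst
  have hTN := hT.smul (hN.comp ((0, x₀), c x₀) (ContinuousLinearMap.snd ℝ (ℝ × E) _).hasFDerivAt)
  have hlin := (ContinuousLinearMap.snd ℝ (ℝ × E) C(I, E) -
    c ∘L ContinuousLinearMap.snd ℝ ℝ E ∘L ContinuousLinearMap.fst ℝ (ℝ × E) _).hasFDerivAt
      (x := ((0, x₀), c x₀))
  refine ((ContinuousLinearMap.fst ℝ (ℝ × E) C(I, E)).hasFDerivAt.prodMk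
    (hlin.sub hTN)).congr_fderiv ?_
  ext1 <;> ext <;> simp [A, c, I]

lemma IsRescaledSolution.comp_mul {f : E → E} {T : ℝ} {x : E} {α β : C(Icc (-1 : ℝ) 1, E)}
    (h : IsRescaledSolution f (T, x) α) (s : Icc (-1 : ℝ) 1)
    (hβ : ∀ r : Icc (-1 : ℝ) 1, β r = α (projIcc (-1) 1 (by norm_num) (s * r))) :
    IsRescaledSolution f (s * T, x) β := by
  intro r
  have hmem : (s : ℝ) * r ∈ Icc (-1 : ℝ) 1 := by
    refine abs_le.1 ?_
    rw [abs_mul]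
    exact mul_le_one₀ (abs_le.2 s.2) (abs_nonneg _) (abs_le.2 r.2)
  calc β r = α ⟨s * r, hmem⟩ := by rw [hβ, projIcc_of_mem]
    _ = x + T • ∫ τ in s * 0..(s * r : ℝ), f (α (projIcc (-1) 1 (by norm_num) τ)) := by
      rw [h, mul_zero]
    _ = x + T • (s : ℝ) • ∫ τ in (0 : ℝ)..r, f (α (projIcc (-1) 1 (by norm_num) (s * τ))) := by
      rw [intervalIntegral.smul_integral_comp_mul_left
        fun τ ↦ f (α (projIcc (-1) 1 (by norm_num) τ))]
    _ = x + (s * T) • ∫ τ in (0 : ℝ)..r, f (β (projIcc (-1) 1 (by norm_num) τ)) := by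
      rw [smul_smul, mul_comm T]
      congr 2
      refine intervalIntegral.integral_congr fun τ hτ ↦ ?_
      have hτ' : τ ∈ Icc (-1 : ℝ) 1 := ordConnected_Icc.uIcc_subset (by norm_num) r.2 hτ
      rw [hβ, projIcc_of_mem _ hτ']

lemma IsRescaledSolution.hasDerivAt [CompleteSpace E] {f : E → E} (hf : Continuous f) {T : ℝ}
    {x : E} {α : C(Icc (-1 : ℝ) 1, E)} (h : IsRescaledSolution f (T, x) α) {t : ℝ} (ht : |t| < T) :
    HasDerivAt (fun s ↦ α (projIcc (-1) 1 (by norm_num) (s / T)))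
      (f (α (projIcc (-1) 1 (by norm_num) (t / T)))) t := by
  have hT : 0 < T := (abs_nonneg t).trans_lt ht
  let g : ℝ → E := fun τ ↦ f (α (projIcc (-1) 1 (by norm_num) τ))
  have hg : Continuous g := hf.comp (α.continuous.comp continuous_projIcc)
  have hint : HasDerivAt (fun s : ℝ ↦ ∫ τ in (0 : ℝ)..(s / T), g τ) (T⁻¹ • g (t / T)) t := by
    simpa [Function.comp_def] using (intervalIntegral.integral_hasDerivAt_right
      (hg.intervalIntegrable 0 (t / T)) hg.stronglyMeasurable.stronglyMeasurableAtFilter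
      hg.continuousAt).scomp t ((hasDerivAt_id t).div_const T)
  refine (((hint.const_smul T).const_add x).congr_deriv ?_).congr_of_eventuallyEq ?_
  · rw [smul_inv_smul₀ hT.ne']
  · filter_upwards [Ioo_mem_nhds (abs_lt.1 ht).1 (abs_lt.1 ht).2] with s hs
    have hs' : s / T ∈ Icc (-1 : ℝ) 1 := by
      rw [mem_Icc, le_div_iff₀ hT, div_le_iff₀ hT]
      constructor <;> linarith [hs.1, hs.2]
    rw [projIcc_of_mem _ hs', h]
    rfl

/-- `α` is a smooth family of rescaled solutions `α (T, x)`, defined for `(T, x)` in the ball of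
radius `δ` about `(0, x₀)`, whose members stay within `r` of `x₀` and are the only solutions with
this property. -/
structure IsSolutionFamily (f : E → E) (x₀ : E) (δ r : ℝ) (α : ℝ × E → C(Icc (-1 : ℝ) 1, E)) :
    Prop where
  contDiffOn : ContDiffOn ℝ ∞ α (Metric.ball (0, x₀) δ)
  isRescaledSolution : ∀ z ∈ Metric.ball (0, x₀) δ, IsRescaledSolution f z (α z)
  dist_lt : ∀ z ∈ Metric.ball (0, x₀) δ, dist (α z) (ContinuousMap.const _ x₀) < r
  unique : ∀ z ∈ Metric.ball (0, x₀) δ, ∀ β : C(Icc (-1 : ℝ) 1, E),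
    dist β (ContinuousMap.const _ x₀) < r → IsRescaledSolution f z β → β = α z

lemma exists_isSolutionFamily [CompleteSpace E] {f : E → E} (hf : ContDiff ℝ ∞ f) (x₀ : E) :
    ∃ δ > 0, ∃ r α, IsSolutionFamily f x₀ δ r α := by
  obtain ⟨e', he'⟩ := exists_hasFDerivAt_flowEquation hf x₀
  obtain ⟨e, hae, -, hef, hsymm⟩ := exists_openPartialHomeomorph_of_contDiffOn isOpen_univ
    (contDiff_flowEquation hf).contDiffOn (mem_univ _) e' he'
  let c₀ : C(Icc (-1 : ℝ) 1, E) := ContinuousMap.const _ x₀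
  obtain ⟨r, hr, hball⟩ := Metric.isOpen_iff.1 e.open_source _ hae
  have he₀ : e ((0, x₀), c₀) = ((0, x₀), 0) := by
    rw [hef, flowEquation_eq_iff]
    exact isRescaledSolution_const f x₀
  let ι : ℝ × E → (ℝ × E) × C(Icc (-1 : ℝ) 1, E) := fun z ↦ (z, 0)
  have hι : ContDiff ℝ ∞ ι := contDiff_id.prodMk contDiff_const
  have hnhds : ι ⁻¹' (e.target ∩ e.symm ⁻¹' Metric.ball ((0, x₀), c₀) r) ∈ 𝓝 (0, x₀) := by
    refine ((e.isOpen_inter_preimage_symm Metric.isOpen_ball).preimage hι.continuous).mem_nhds ?_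
    change ((0, x₀), (0 : C(Icc (-1 : ℝ) 1, E))) ∈
      e.target ∩ e.symm ⁻¹' Metric.ball ((0, x₀), c₀) r
    rw [← he₀]
    exact ⟨e.map_source hae, by rw [mem_preimage, e.left_inv hae]; exact Metric.mem_ball_self hr⟩
  obtain ⟨δ, hδ, hδι⟩ := Metric.mem_nhds_iff.1 hnhds
  have hfst : ∀ z ∈ Metric.ball ((0 : ℝ), x₀) δ, e.symm (ι z) = (z, (e.symm (ι z)).2) := by
    intro z hz
    have hz' := e.right_inv (hδι hz).1
    rw [hef] at hz'
    have hz₁ : (e.symm (ι z)).1 = z := congrArg Prod.fst hz'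
    exact Prod.ext hz₁ rfl
  have hdist : ∀ z ∈ Metric.ball ((0 : ℝ), x₀) δ,
      z ∈ Metric.ball (0, x₀) r ∧ (e.symm (ι z)).2 ∈ Metric.ball c₀ r := by
    intro z hz
    have hz' := (hδι hz).2
    rwa [mem_preimage, hfst z hz, ← ball_prod_same] at hz'
  refine ⟨δ, hδ, r, fun z ↦ (e.symm (ι z)).2,
    contDiff_snd.comp_contDiffOn (hsymm.comp hι.contDiffOn fun z hz ↦ (hδι hz).1), fun z hz ↦ ?_,
    fun z hz ↦ (hdist z hz).2, fun z hz β hβ hsol ↦ ?_⟩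
  · rw [← flowEquation_eq_iff hf.continuous, ← hfst z hz, ← hef]
    exact e.right_inv (hδι hz).1
  · have hβs : (z, β) ∈ e.source := by
      refine hball ?_
      rw [← ball_prod_same]
      exact ⟨(hdist z hz).1, hβ⟩
    rw [← flowEquation_eq_iff hf.continuous, ← hef] at hsol
    change β = (e.symm (z, 0)).2
    rw [← hsol, e.left_inv hβs]

-- `r ↦ α (T, x) (s r)` solves the rescaled problem with elapsed time `s T`.
lemma IsSolutionFamily.apply_mul {f : E → E} {x₀ : E} {δ r : ℝ}
    {α : ℝ × E → C(Icc (-1 : ℝ) 1, E)} (h : IsSolutionFamily f x₀ δ r α) {T : ℝ} {x : E}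
    (hT : (T, x) ∈ Metric.ball (0, x₀) δ) (s : Icc (-1 : ℝ) 1) :
    α (s * T, x) ⟨1, by norm_num⟩ = α (T, x) s := by
  have hsT : ((s : ℝ) * T, x) ∈ Metric.ball ((0 : ℝ), x₀) δ := by
    rw [← ball_prod_same, mem_prod, mem_ball_zero_iff] at hT ⊢
    refine ⟨?_, hT.2⟩
    rw [norm_mul]
    exact (mul_le_of_le_one_left (norm_nonneg _) (abs_le.2 s.2)).trans_lt hT.1
  let β : C(Icc (-1 : ℝ) 1, E) :=
    ⟨fun r ↦ α (T, x) (projIcc (-1) 1 (by norm_num) (s * r)),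
      (α (T, x)).continuous.comp ((continuous_projIcc (h := by norm_num)).comp (by fun_prop))⟩
  have hβ : IsRescaledSolution f (s * T, x) β :=
    (h.isRescaledSolution _ hT).comp_mul s fun r ↦ rfl
  have hdist : dist β (ContinuousMap.const _ x₀) < r := by
    refine lt_of_le_of_lt ?_ (h.dist_lt _ hT)
    rw [ContinuousMap.dist_le dist_nonneg]
    exact fun r ↦ ContinuousMap.dist_apply_le_dist (f := α (T, x)) (g := .const _ x₀) _
  rw [← h.unique _ hsT β hdist hβ]
  change α (T, x) (projIcc (-1) 1 (by norm_num) (s * 1)) = _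
  rw [mul_one, projIcc_val]

lemma IsSolutionFamily.hasDerivAt [CompleteSpace E] {f : E → E} (hf : Continuous f) {x₀ : E}
    {δ r : ℝ} {α : ℝ × E → C(Icc (-1 : ℝ) 1, E)} (h : IsSolutionFamily f x₀ δ r α) {t : ℝ} {x : E}
    (htx : (t, x) ∈ Metric.ball (0, x₀) δ) :
    HasDerivAt (fun s ↦ α (s, x) ⟨1, by norm_num⟩) (f (α (t, x) ⟨1, by norm_num⟩)) t := by
  rw [← ball_prod_same, mem_prod, mem_ball_zero_iff, Real.norm_eq_abs] at htx
  obtain ⟨T, htT, hTδ⟩ := exists_between htx.1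
  have hT : 0 < T := (abs_nonneg t).trans_lt htT
  have hTx : (T, x) ∈ Metric.ball ((0 : ℝ), x₀) δ := by
    rw [← ball_prod_same, mem_prod, mem_ball_zero_iff, Real.norm_eq_abs, abs_of_pos hT]
    exact ⟨hTδ, htx.2⟩
  have happly : ∀ s, |s| < T →
      α (s, x) ⟨1, by norm_num⟩ = α (T, x) (projIcc (-1) 1 (by norm_num) (s / T)) := by
    intro s hs
    have hs' : s / T ∈ Icc (-1 : ℝ) 1 := by
      rw [mem_Icc, le_div_iff₀ hT, div_le_iff₀ hT]
      constructor <;> linarith [(abs_lt.1 hs).1, (abs_lt.1 hs).2]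
    simpa [projIcc_of_mem _ hs', div_mul_cancel₀ _ hT.ne'] using h.apply_mul hTx ⟨s / T, hs'⟩
  rw [happly t htT]
  refine ((h.isRescaledSolution _ hTx).hasDerivAt hf htT).congr_of_eventuallyEq ?_
  filter_upwards [Ioo_mem_nhds (abs_lt.1 htT).1 (abs_lt.1 htT).2] with s hs
    using happly s (abs_lt.2 hs)

theorem exists_contDiffOn_flow [CompleteSpace E] [HasContDiffBump E] {f : E → E} {W : Set E}
    (hW : IsOpen W) (hf : ContDiffOn ℝ ∞ f W) {x₀ : E} (hx₀ : x₀ ∈ W) :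
    ∃ (φ : ℝ × E → E) (U : Set (ℝ × E)), IsOpen U ∧ (0, x₀) ∈ U ∧ ContDiffOn ℝ ∞ φ U ∧
      MapsTo φ U W ∧ (∀ x, (0, x) ∈ U → φ (0, x) = x) ∧
      ∀ t x, (t, x) ∈ U → HasDerivAt (fun s ↦ φ (s, x)) (f (φ (t, x))) t := by
  obtain ⟨f', hf', heq⟩ := exists_contDiff_eventuallyEq hW hf hx₀
  obtain ⟨V, hVeq, hV, hx₀V⟩ := eventually_nhds_iff.1 (heq.and (hW.mem_nhds hx₀))
  obtain ⟨δ, hδ, r, α, h⟩ := exists_isSolutionFamily hf' x₀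
  let φ : ℝ × E → E := fun z ↦ α z ⟨1, by norm_num⟩
  have hφ : ContDiffOn ℝ ∞ φ (Metric.ball (0, x₀) δ) :=
    (ContinuousMap.evalCLM ℝ (⟨1, by norm_num⟩ : Icc (-1 : ℝ) 1) :
      C(Icc (-1 : ℝ) 1, E) →L[ℝ] E).contDiff.comp_contDiffOn h.contDiffOn
  have hφ₀ : ∀ x, (0, x) ∈ Metric.ball ((0 : ℝ), x₀) δ → φ (0, x) = x := fun x hx ↦ by
    simpa using h.isRescaledSolution _ hx ⟨1, by norm_num⟩
  refine ⟨φ, Metric.ball (0, x₀) δ ∩ φ ⁻¹' V,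
    hφ.continuousOn.isOpen_inter_preimage Metric.isOpen_ball hV,
    ⟨Metric.mem_ball_self hδ, ?_⟩, hφ.mono inter_subset_left, fun z hz ↦ (hVeq _ hz.2).2,
    fun x hx ↦ hφ₀ x hx.1, fun t x htx ↦ ?_⟩
  · rwa [mem_preimage, hφ₀ _ (Metric.mem_ball_self hδ)]
  · rw [← (hVeq _ htx.2).1]
    exact h.hasDerivAt hf'.continuous htx.1

end Flow

section FlowBox

variable {E F : Type*} [NormedAddCommGroup E] [NormedSpace ℝ E] [NormedAddCommGroup F]
  [NormedSpace ℝ F] {τ : F →L[ℝ] ℝ} {e : F}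

/-- The projection onto the hyperplane `ker τ` along `e`, for `τ e = 1`. -/
def projKer (τ : F →L[ℝ] ℝ) (e : F) : F →L[ℝ] F :=
  .id ℝ F - τ.smulRight e

lemma projKer_apply (y : F) : projKer τ e y = y - τ y • e := rfl

lemma projKer_add_smul (y : F) : projKer τ e y + τ y • e = y := sub_add_cancel _ _

lemma projKer_of_apply_eq_zero {y : F} (hy : τ y = 0) : projKer τ e y = y := by
  simp [projKer_apply, hy]

lemma apply_projKer (hτ : τ e = 1) (y : F) : τ (projKer τ e y) = 0 := by
  simp [projKer_apply, hτ]

lemma projKer_add_smul_self (hτ : τ e = 1) (y : F) (t : ℝ) :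
    projKer τ e (y + t • e) = projKer τ e y := by
  simp [projKer_apply, hτ, add_smul]

/-- The points whose components along `e` and along the hyperplane `ker τ` both have norm less
than `δ`. In contrast to a ball, it is invariant under `projKer τ e` and is a union of segments of
lines parallel to `e` that all meet `ker τ`. -/
def flowBox (τ : F →L[ℝ] ℝ) (e : F) (δ : ℝ) : Set F :=
  {y | ‖τ y‖ < δ ∧ ‖projKer τ e y‖ < δ}

lemma isOpen_flowBox (δ : ℝ) : IsOpen (flowBox τ e δ) :=
  (isOpen_lt τ.continuous.norm continuous_const).inter
    (isOpen_lt (projKer τ e).continuous.norm continuous_const)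

lemma zero_mem_flowBox {δ : ℝ} (hδ : 0 < δ) : (0 : F) ∈ flowBox τ e δ := by
  simpa [flowBox] using hδ

lemma projKer_add_smul_mem_flowBox (hτ : τ e = 1) {δ t : ℝ} {y : F} (hy : y ∈ flowBox τ e δ)
    (ht : t ∈ Ioo (-δ) δ) : projKer τ e y + t • e ∈ flowBox τ e δ := by
  refine ⟨?_, ?_⟩
  · simpa [apply_projKer hτ, hτ] using abs_lt.2 ht
  · rw [projKer_add_smul_self hτ, projKer_of_apply_eq_zero (apply_projKer hτ y)]
    exact hy.2

lemma projKer_mem_flowBox (hτ : τ e = 1) {δ : ℝ} {y : F} (hy : y ∈ flowBox τ e δ) :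
    projKer τ e y ∈ flowBox τ e δ := by
  have hδ : 0 < δ := (norm_nonneg _).trans_lt hy.1
  simpa using projKer_add_smul_mem_flowBox hτ hy (t := 0) ⟨neg_lt_zero.2 hδ, hδ⟩

lemma exists_flowBox_subset (τ : F →L[ℝ] ℝ) (e : F) {U : Set F} (hU : U ∈ 𝓝 0) :
    ∃ δ > 0, flowBox τ e δ ⊆ U := by
  let recombine : ℝ × F →L[ℝ] F := (ContinuousLinearMap.fst ℝ ℝ F).smulRight e + .snd ℝ ℝ F
  have hpre : recombine ⁻¹' U ∈ 𝓝 0 :=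
    recombine.continuous.continuousAt.preimage_mem_nhds (by simpa using hU)
  obtain ⟨δ, hδ, hball⟩ := Metric.mem_nhds_iff.1 hpre
  refine ⟨δ, hδ, fun y hy ↦ ?_⟩
  have hmem : (τ y, projKer τ e y) ∈ Metric.ball (0 : ℝ × F) δ :=
    mem_ball_zero_iff.2 (max_lt hy.1 hy.2)
  simpa [recombine, add_comm, projKer_add_smul] using hball hmem

lemma hasDerivAt_comp_add_smul {f : F → E} {y : F} {s : ℝ} (v : F)
    (hf : DifferentiableAt ℝ f (y + s • v)) :
    HasDerivAt (fun t : ℝ ↦ f (y + t • v)) (fderiv ℝ f (y + s • v) v) s := by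
  have hline : HasDerivAt (fun t : ℝ ↦ y + t • v) v s := by
    simpa using ((hasDerivAt_id s).smul_const v).const_add y
  exact hf.hasFDerivAt.comp_hasDerivAt s hline

lemma eq_apply_projKer_of_fderiv_eq_zero (hτ : τ e = 1) {δ : ℝ} {f : F → E}
    (hf : DifferentiableOn ℝ f (flowBox τ e δ))
    (hf' : ∀ y ∈ flowBox τ e δ, fderiv ℝ f y e = 0) {y : F} (hy : y ∈ flowBox τ e δ) :
    f y = f (projKer τ e y) := by
  have hδ : 0 < δ := (norm_nonneg _).trans_lt hy.1
  have hder : ∀ t ∈ Ioo (-δ) δ, HasDerivAt (fun t : ℝ ↦ f (projKer τ e y + t • e)) 0 t := by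
    intro t ht
    have hmem := projKer_add_smul_mem_flowBox hτ hy ht
    rw [← hf' _ hmem]
    exact hasDerivAt_comp_add_smul e (hf.differentiableAt ((isOpen_flowBox δ).mem_nhds hmem))
  have hconst := isOpen_Ioo.is_const_of_deriv_eq_zero isPreconnected_Ioo
    (fun t ht ↦ (hder t ht).differentiableAt.differentiableWithinAt)
    (fun t ht ↦ (hder t ht).deriv) (abs_lt.1 hy.1) (y := 0) ⟨neg_lt_zero.2 hδ, hδ⟩
  simpa [projKer_add_smul] using hconst

lemma fderiv_apply_eq_of_eqOn_hyperplane {f g : F → E} {N : Set F} (hN : IsOpen N)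
    (hfg : ∀ y ∈ N, τ y = 0 → f y = g y) {y w : F} (hy : y ∈ N) (hτy : τ y = 0) (hτw : τ w = 0)
    (hf : DifferentiableAt ℝ f y) (hg : DifferentiableAt ℝ g y) :
    fderiv ℝ f y w = fderiv ℝ g y w := by
  have hline : ∀ᶠ t : ℝ in 𝓝 0, y + t • w ∈ N := by
    have : ContinuousAt (fun t : ℝ ↦ y + t • w) 0 := by fun_prop
    exact this (hN.mem_nhds (by simpa using hy))
  have hf' : HasDerivAt (fun t : ℝ ↦ f (y + t • w)) _ 0 := hf.hasFDerivAt.hasLineDerivAt w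
  refine hf'.unique (HasDerivAt.congr_of_eventuallyEq (hg.hasFDerivAt.hasLineDerivAt w) ?_)
  filter_upwards [hline] with t ht
  exact hfg _ ht (by simp [hτy, hτw])

variable {X : Type*} [NormedAddCommGroup X] [NormedSpace ℝ X] [CompleteSpace X]
  [HasContDiffBump X]

theorem exists_flow_box (hτ : τ e = 1) {W : Set X} (hW : IsOpen W) {f : X → X}
    (hf : ContDiffOn ℝ ∞ f W) {V : Set F} (hV : IsOpen V) (h0V : 0 ∈ V) {s : F → X}
    (hs : ContDiffOn ℝ ∞ s V) (hsW : s 0 ∈ W) :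
    ∃ δ > 0, ∃ Φ : F → X, ContDiffOn ℝ ∞ Φ (flowBox τ e δ) ∧ MapsTo Φ (flowBox τ e δ) W ∧
      (∀ y ∈ flowBox τ e δ, fderiv ℝ Φ y e = f (Φ y)) ∧
      ∀ y ∈ flowBox τ e δ, τ y = 0 → y ∈ V ∧ Φ y = s y := by
  obtain ⟨φ, U, hU, h0U, hφ, hφW, hφ0, hφ'⟩ := exists_contDiffOn_flow hW hf hsW
  let pr := projKer τ e
  let start : F → ℝ × X := fun y ↦ (τ y, s (pr y))
  have hstart : ContDiffOn ℝ ∞ start (pr ⁻¹' V) :=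
    τ.contDiff.contDiffOn.prodMk (hs.comp pr.contDiff.contDiffOn fun _ hy ↦ hy)
  have hopen : IsOpen (pr ⁻¹' V ∩ start ⁻¹' U) :=
    hstart.continuousOn.isOpen_inter_preimage (hV.preimage pr.continuous) hU
  obtain ⟨δ, hδ, hbox⟩ := exists_flowBox_subset τ e
    (hopen.mem_nhds (x := 0) ⟨by simpa using h0V, by simpa [start] using h0U⟩)
  have hΦ : ContDiffOn ℝ ∞ (φ ∘ start) (flowBox τ e δ) :=
    hφ.comp (hstart.mono (hbox.trans inter_subset_left)) fun y hy ↦ (hbox hy).2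
  refine ⟨δ, hδ, φ ∘ start, hΦ, fun y hy ↦ hφW (hbox hy).2, fun y hy ↦ ?_, fun y hy hτy ↦ ?_⟩
  · have hdiff : DifferentiableAt ℝ (φ ∘ start) (y + (0 : ℝ) • e) := by
      simpa using (hΦ.contDiffAt ((isOpen_flowBox δ).mem_nhds hy)).differentiableAt (by simp)
    have hline : (fun t : ℝ ↦ (φ ∘ start) (y + t • e)) = fun t ↦ φ (τ y + t, s (pr y)) := by
      funext t
      simp [start, pr, hτ, projKer_add_smul_self]
    have hline' := hline ▸ hasDerivAt_comp_add_smul e hdiff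
    have hflow := HasDerivAt.comp_const_add (τ y) 0 (by simpa using hφ' (τ y) _ (hbox hy).2)
    simpa using hline'.unique hflow
  · obtain ⟨hyV, hyU⟩ := hbox hy
    simp only [mem_preimage, start, pr, hτy, projKer_of_apply_eq_zero hτy] at hyV hyU
    exact ⟨hyV, by simpa [start, pr, hτy, projKer_of_apply_eq_zero hτy] using hφ0 _ hyU⟩

end FlowBox

lemma eventuallyEq_of_hasDerivAt_of_contDiffAt {X : Type*} [NormedAddCommGroup X] [NormedSpace ℝ X]
    {f : X → X} {u z : ℝ → X} {t₀ : ℝ} (hf : ContDiffAt ℝ 1 f (u t₀))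
    (hu : ∀ᶠ t in 𝓝 t₀, HasDerivAt u (f (u t)) t) (hz : ∀ᶠ t in 𝓝 t₀, HasDerivAt z (f (z t)) t)
    (huz : u t₀ = z t₀) : u =ᶠ[𝓝 t₀] z := by
  obtain ⟨K, s, hs, hK⟩ := hf.exists_lipschitzOnWith
  have hus : ∀ᶠ t in 𝓝 t₀, u t ∈ s := hu.self_of_nhds.continuousAt hs
  have hzs : ∀ᶠ t in 𝓝 t₀, z t ∈ s := hz.self_of_nhds.continuousAt (huz ▸ hs)
  exact ODE_solution_unique_of_eventually (v := fun _ ↦ f) (s := fun _ ↦ s) (.of_forall fun _ ↦ hK)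
    (hu.and hus) (hz.and hzs) huz

section Geodesics

variable {E F : Type*} [NormedAddCommGroup E] [NormedSpace ℝ E] [NormedAddCommGroup F]
  [NormedSpace ℝ F] {B : E → E →L[ℝ] E →L[ℝ] ℝ} {Ω : Set E} {N : Set F} {e : F} {Ψ : F → E} {y : F}

/-- A pseudo-Riemannian metric on the open set `Ω`, given by its field of Gram forms. -/
structure IsPseudoRiemannianMetricOn (B : E → E →L[ℝ] E →L[ℝ] ℝ) (Ω : Set E) : Prop where
  isOpen : IsOpen Ω
  contDiffOn : ContDiffOn ℝ ∞ B Ω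
  symm : ∀ x ∈ Ω, ∀ v w, B x v w = B x w v
  isInvertible : ∀ x ∈ Ω, (B x).IsInvertible

/-- The cogeodesic field of the metric `B`, whose integral curves are the pairs of a geodesic and
its momentum `B x x'`. In the Lagrangian form used here, the force is half of `∂B (x', x')`. -/
def cogeodesicField (B : E → E →L[ℝ] E →L[ℝ] ℝ) (z : E × (E →L[ℝ] ℝ)) : E × (E →L[ℝ] ℝ) :=
  ((B z.1).inverse z.2,
    (1 / 2 : ℝ) • ((fderiv ℝ B z.1).flip ((B z.1).inverse z.2)).flip ((B z.1).inverse z.2))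

lemma cogeodesicField_momentum {x : E} (hB : (B x).IsInvertible) (v : E) :
    cogeodesicField B (x, B x v) = (v, (1 / 2 : ℝ) • ((fderiv ℝ B x).flip v).flip v) := by
  simp [cogeodesicField, hB.inverse_apply_self]

lemma cogeodesicField_snd_apply (x : E) (p : E →L[ℝ] ℝ) (w : E) :
    (cogeodesicField B (x, p)).2 w =
      1 / 2 * fderiv ℝ B x w ((B x).inverse p) ((B x).inverse p) :=
  rfl

lemma IsPseudoRiemannianMetricOn.contDiffOn_inverse [CompleteSpace E]
    (hB : IsPseudoRiemannianMetricOn B Ω) : ContDiffOn ℝ ∞ (fun x ↦ (B x).inverse) Ω :=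
  fun x hx ↦ ((hB.isInvertible x hx).contDiffAt_map_inverse.comp x
    (hB.contDiffOn.contDiffAt (hB.isOpen.mem_nhds hx))).contDiffWithinAt

lemma contDiffOn_flip {G H K : Type*} [NormedAddCommGroup G] [NormedSpace ℝ G]
    [NormedAddCommGroup H] [NormedSpace ℝ H] [NormedAddCommGroup K] [NormedSpace ℝ K]
    {q : E → G →L[ℝ] H →L[ℝ] K} {s : Set E} (hq : ContDiffOn ℝ ∞ q s) :
    ContDiffOn ℝ ∞ (fun x ↦ (q x).flip) s :=
  (ContinuousLinearMap.flipₗᵢ ℝ G H K).contDiff.comp_contDiffOn hq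

lemma IsPseudoRiemannianMetricOn.contDiffOn_cogeodesicField [CompleteSpace E]
    (hB : IsPseudoRiemannianMetricOn B Ω) :
    ContDiffOn ℝ ∞ (cogeodesicField B) (Ω ×ˢ univ) := by
  have hfst : MapsTo Prod.fst (Ω ×ˢ (univ : Set (E →L[ℝ] ℝ))) Ω := fun z hz ↦ hz.1
  have hvel : ContDiffOn ℝ ∞ (fun z : E × (E →L[ℝ] ℝ) ↦ (B z.1).inverse z.2) (Ω ×ˢ univ) :=
    (hB.contDiffOn_inverse.comp contDiffOn_fst hfst).clm_apply contDiffOn_snd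
  have hfderiv : ContDiffOn ℝ ∞ (fun z : E × (E →L[ℝ] ℝ) ↦ fderiv ℝ B z.1) (Ω ×ˢ univ) :=
    (hB.contDiffOn.fderiv_of_isOpen hB.isOpen (by simp)).comp contDiffOn_fst hfst
  have hforce := contDiffOn_flip ((contDiffOn_flip hfderiv).clm_apply hvel)
  exact hvel.prodMk ((hforce.clm_apply hvel).const_smul _)

/-- The covector `B (∂ₑΨ, ·)` dual to the velocity in the direction `e` of the family of curves
`t ↦ Ψ (y + t • e)`. -/
def momentum (B : E → E →L[ℝ] E →L[ℝ] ℝ) (e : F) (Ψ : F → E) (y : F) : E →L[ℝ] ℝ :=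
  B (Ψ y) (fderiv ℝ Ψ y e)

/-- `Ψ : N → Ω` is a smooth family of geodesics `t ↦ Ψ (y + t • e)` of the metric `B` on `Ω`; the
geodesic equation is stated in Lagrangian form. -/
structure IsGeodesicFamily (B : E → E →L[ℝ] E →L[ℝ] ℝ) (Ω : Set E) (e : F) (N : Set F)
    (Ψ : F → E) : Prop where
  isOpen : IsOpen N
  contDiffOn : ContDiffOn ℝ ∞ Ψ N
  mapsTo : MapsTo Ψ N Ω
  fderiv_momentum : ∀ y ∈ N, ∀ w,
    fderiv ℝ (momentum B e Ψ) y e w =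
      1 / 2 * fderiv ℝ B (Ψ y) w (fderiv ℝ Ψ y e) (fderiv ℝ Ψ y e)

namespace IsGeodesicFamily

lemma differentiableAt (hΨ : IsGeodesicFamily B Ω e N Ψ) (hy : y ∈ N) : DifferentiableAt ℝ Ψ y :=
  (hΨ.contDiffOn.contDiffAt (hΨ.isOpen.mem_nhds hy)).differentiableAt (by simp)

lemma contDiffOn_fderiv_apply (hΨ : IsGeodesicFamily B Ω e N Ψ) (w : F) :
    ContDiffOn ℝ ∞ (fun z ↦ fderiv ℝ Ψ z w) N :=
  (hΨ.contDiffOn.fderiv_of_isOpen hΨ.isOpen (by simp)).clm_apply contDiffOn_const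

lemma contDiffOn_momentum (hB : IsPseudoRiemannianMetricOn B Ω)
    (hΨ : IsGeodesicFamily B Ω e N Ψ) : ContDiffOn ℝ ∞ (momentum B e Ψ) N :=
  (hB.contDiffOn.comp hΨ.contDiffOn hΨ.mapsTo).clm_apply (hΨ.contDiffOn_fderiv_apply e)

lemma differentiableOn_momentum_apply (hB : IsPseudoRiemannianMetricOn B Ω)
    (hΨ : IsGeodesicFamily B Ω e N Ψ) (w : F) :
    DifferentiableOn ℝ (fun z ↦ momentum B e Ψ z (fderiv ℝ Ψ z w)) N :=
  ((hΨ.contDiffOn_momentum hB).clm_apply (hΨ.contDiffOn_fderiv_apply w)).differentiableOn (by simp)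

lemma hasDerivAt_momentum (hB : IsPseudoRiemannianMetricOn B Ω) (hΨ : IsGeodesicFamily B Ω e N Ψ)
    {t : ℝ} (ht : t • e ∈ N) :
    HasDerivAt (fun t : ℝ ↦ (Ψ (t • e), momentum B e Ψ (t • e)))
      (cogeodesicField B (Ψ (t • e), momentum B e Ψ (t • e))) t := by
  have hline : HasDerivAt (fun t : ℝ ↦ t • e) e t := by
    simpa using (hasDerivAt_id t).smul_const e
  have hmom : HasFDerivAt (momentum B e Ψ) _ (t • e) :=
    (((hΨ.contDiffOn_momentum hB).contDiffAt (hΨ.isOpen.mem_nhds ht)).differentiableAt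
      (by simp)).hasFDerivAt
  have hforce : fderiv ℝ (momentum B e Ψ) (t • e) e =
      (1 / 2 : ℝ) • ((fderiv ℝ B (Ψ (t • e))).flip (fderiv ℝ Ψ (t • e) e)).flip
        (fderiv ℝ Ψ (t • e) e) := by
    ext w
    simpa using hΨ.fderiv_momentum _ ht w
  rw [momentum, cogeodesicField_momentum (hB.isInvertible _ (hΨ.mapsTo ht)), ← hforce]
  exact HasFDerivAt.comp_hasDerivAt (f := fun t : ℝ ↦ t • e) t
    ((hΨ.differentiableAt ht).hasFDerivAt.prodMk hmom) hline

-- Both sides differentiate `B (∂ₑΨ, ∂_wΨ)` resp. `B (∂ₑΨ, ∂ₑΨ) / 2`; they agree by the geodesic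
-- equation and the symmetry `∂ₑ∂_wΨ = ∂_w∂ₑΨ`.
lemma fderiv_momentum_apply (hB : IsPseudoRiemannianMetricOn B Ω)
    (hΨ : IsGeodesicFamily B Ω e N Ψ) (hy : y ∈ N) (w : F) :
    fderiv ℝ (fun z ↦ momentum B e Ψ z (fderiv ℝ Ψ z w)) y e =
      1 / 2 * fderiv ℝ (fun z ↦ momentum B e Ψ z (fderiv ℝ Ψ z e)) y w := by
  have hNy := hΨ.isOpen.mem_nhds hy
  have hsmooth := hΨ.contDiffOn.contDiffAt hNy
  have hmom : HasFDerivAt (momentum B e Ψ) _ y :=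
    (((hΨ.contDiffOn_momentum hB).contDiffAt hNy).differentiableAt (by simp)).hasFDerivAt
  have hmetric : HasFDerivAt (fun z ↦ B (Ψ z)) _ y :=
    ((hB.contDiffOn.contDiffAt (hB.isOpen.mem_nhds (hΨ.mapsTo hy))).differentiableAt
      (by simp)).hasFDerivAt.comp y (hΨ.differentiableAt hy).hasFDerivAt
  have hvel (w : F) :
      HasFDerivAt (fun z ↦ fderiv ℝ Ψ z w) ((fderiv ℝ (fderiv ℝ Ψ) y).flip w) y := by
    simpa using ((hsmooth.fderiv_right (m := ∞) (by simp)).differentiableAt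
      (by simp)).hasFDerivAt.clm_apply (hasFDerivAt_const w y)
  have hsecond : fderiv ℝ (fderiv ℝ Ψ) y e w = fderiv ℝ (fderiv ℝ Ψ) y w e :=
    (hsmooth.isSymmSndFDerivAt (by
      rw [minSmoothness_of_isRCLikeNormedField]; exact ENat.LEInfty.out)).eq e w
  have hpair : HasFDerivAt (fun z ↦ momentum B e Ψ z (fderiv ℝ Ψ z w)) _ y :=
    hmom.clm_apply (hvel w)
  have henergy : HasFDerivAt (fun z ↦ momentum B e Ψ z (fderiv ℝ Ψ z e)) _ y :=
    (hmetric.clm_apply (hvel e)).clm_apply (hvel e)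
  rw [hpair.fderiv, henergy.fderiv]
  simp [hΨ.fderiv_momentum y hy, momentum, hsecond, hB.symm _ (hΨ.mapsTo hy) _ (fderiv ℝ Ψ y e)]
  ring

end IsGeodesicFamily

end Geodesics

section NullGeodesicFamilies

variable {E F : Type*} [NormedAddCommGroup E] [NormedSpace ℝ E] [NormedAddCommGroup F]
  [NormedSpace ℝ F] {B : E → E →L[ℝ] E →L[ℝ] ℝ} {Ω : Set E} {τ : F →L[ℝ] ℝ} {e : F}

lemma IsGeodesicFamily.momentum_apply_velocity {δ : ℝ} {Ψ : F → E}
    (hΨ : IsGeodesicFamily B Ω e (flowBox τ e δ) Ψ) (hB : IsPseudoRiemannianMetricOn B Ω)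
    (hτ : τ e = 1) {y : F} (hy : y ∈ flowBox τ e δ) :
    momentum B e Ψ y (fderiv ℝ Ψ y e) =
      momentum B e Ψ (projKer τ e y) (fderiv ℝ Ψ (projKer τ e y) e) :=
  eq_apply_projKer_of_fderiv_eq_zero hτ (hΨ.differentiableOn_momentum_apply hB e)
    (fun z hz ↦ by linarith [hΨ.fderiv_momentum_apply hB hz e]) hy

lemma IsGeodesicFamily.momentum_apply_fderiv {δ : ℝ} {Ψ : F → E}
    (hΨ : IsGeodesicFamily B Ω e (flowBox τ e δ) Ψ) (hB : IsPseudoRiemannianMetricOn B Ω)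
    (hτ : τ e = 1)
    (hnull : ∀ y ∈ flowBox τ e δ, τ y = 0 → momentum B e Ψ y (fderiv ℝ Ψ y e) = 0)
    {y : F} (hy : y ∈ flowBox τ e δ) (w : F) :
    momentum B e Ψ y (fderiv ℝ Ψ y w) =
      momentum B e Ψ (projKer τ e y) (fderiv ℝ Ψ (projKer τ e y) w) := by
  refine eq_apply_projKer_of_fderiv_eq_zero hτ (hΨ.differentiableOn_momentum_apply hB w)
    (fun z hz ↦ ?_) hy
  have henergy : (fun y ↦ momentum B e Ψ y (fderiv ℝ Ψ y e)) =ᶠ[𝓝 z] fun _ ↦ 0 := by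
    filter_upwards [(isOpen_flowBox δ).mem_nhds hz] with x hx
    rw [hΨ.momentum_apply_velocity hB hτ hx]
    exact hnull _ (projKer_mem_flowBox hτ hx) (apply_projKer hτ x)
  rw [hΨ.fderiv_momentum_apply hB hz w, henergy.fderiv_eq]
  simp

theorem exists_isGeodesicFamily [FiniteDimensional ℝ E] (hB : IsPseudoRiemannianMetricOn B Ω)
    (hτ : τ e = 1) {V : Set F} (hV : IsOpen V) (h0V : 0 ∈ V) {a : F → E} {p : F → E →L[ℝ] ℝ}
    (ha : ContDiffOn ℝ ∞ a V) (hp : ContDiffOn ℝ ∞ p V) (haΩ : a 0 ∈ Ω) :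
    ∃ δ > 0, ∃ Ψ : F → E, IsGeodesicFamily B Ω e (flowBox τ e δ) Ψ ∧
      ∀ y ∈ flowBox τ e δ, τ y = 0 → y ∈ V ∧ Ψ y = a y ∧ momentum B e Ψ y = p y := by
  obtain ⟨δ, hδ, Φ, hΦ, hΦΩ, hflow, hstart⟩ := exists_flow_box hτ (hB.isOpen.prod isOpen_univ)
    hB.contDiffOn_cogeodesicField hV h0V (ha.prodMk hp) ⟨haΩ, mem_univ _⟩
  let Ψ : F → E := fun y ↦ (Φ y).1
  have hΦ' : ∀ y ∈ flowBox τ e δ, HasFDerivAt Φ (fderiv ℝ Φ y) y := fun y hy ↦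
    ((hΦ.contDiffAt ((isOpen_flowBox δ).mem_nhds hy)).differentiableAt (by simp)).hasFDerivAt
  have hvel : ∀ y ∈ flowBox τ e δ, fderiv ℝ Ψ y e = (B (Ψ y)).inverse (Φ y).2 := by
    intro y hy
    rw [(hΦ' y hy).fst.fderiv, ContinuousLinearMap.comp_apply, hflow y hy]
    rfl
  have hmom : ∀ y ∈ flowBox τ e δ, momentum B e Ψ y = (Φ y).2 := by
    intro y hy
    rw [momentum, hvel y hy, (hB.isInvertible _ (hΦΩ hy).1).self_apply_inverse]
  refine ⟨δ, hδ, Ψ, ⟨isOpen_flowBox δ, contDiff_fst.comp_contDiffOn hΦ, fun y hy ↦ (hΦΩ hy).1,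
    fun y hy w ↦ ?_⟩, fun y hy hτy ↦ ?_⟩
  · have heq : momentum B e Ψ =ᶠ[𝓝 y] fun z ↦ (Φ z).2 := by
      filter_upwards [(isOpen_flowBox δ).mem_nhds hy] with z hz using hmom z hz
    rw [heq.fderiv_eq, (hΦ' y hy).snd.fderiv, ContinuousLinearMap.comp_apply, hflow y hy,
      hvel y hy]
    exact cogeodesicField_snd_apply _ _ w
  · obtain ⟨hyV, hΦy⟩ := hstart y hy hτy
    exact ⟨hyV, congrArg Prod.fst hΦy, (hmom y hy).trans (congrArg Prod.snd hΦy)⟩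

lemma exists_contDiffOn_quadratic_root {a b d : E → ℝ} (hΩ : IsOpen Ω) (ha : ContDiffOn ℝ ∞ a Ω)
    (hb : ContDiffOn ℝ ∞ b Ω) (hd : ContDiffOn ℝ ∞ d Ω) {x₀ : E} (hx₀ : x₀ ∈ Ω) (hbx₀ : 0 < b x₀)
    (hdx₀ : d x₀ = 0) :
    ∃ (c : E → ℝ) (V : Set E), IsOpen V ∧ x₀ ∈ V ∧ V ⊆ Ω ∧ ContDiffOn ℝ ∞ c V ∧ c x₀ = 0 ∧
      ∀ x ∈ V, a x * c x ^ 2 + 2 * b x * c x + d x = 0 := by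
  let disc : E → ℝ := fun x ↦ b x ^ 2 - a x * d x
  have hdisc : ContDiffOn ℝ ∞ disc Ω := (hb.pow 2).sub (ha.mul hd)
  let V : Set E := (Ω ∩ b ⁻¹' Ioi 0) ∩ (Ω ∩ disc ⁻¹' Ioi 0)
  have hVΩ : V ⊆ Ω := fun x hx ↦ hx.1.1
  have hpos : ∀ x ∈ V, 0 < b x + √(disc x) := fun x hx ↦
    add_pos_of_pos_of_nonneg hx.1.2 (Real.sqrt_nonneg _)
  refine ⟨fun x ↦ -d x / (b x + √(disc x)), V,
    (hb.continuousOn.isOpen_inter_preimage hΩ isOpen_Ioi).inter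
      (hdisc.continuousOn.isOpen_inter_preimage hΩ isOpen_Ioi),
    ⟨⟨hx₀, hbx₀⟩, hx₀, ?_⟩, hVΩ, ?_, by simp [hdx₀], fun x hx ↦ ?_⟩
  · simpa only [mem_preimage, mem_Ioi, disc, hdx₀, mul_zero, sub_zero] using pow_pos hbx₀ 2
  · exact (hd.mono hVΩ).neg.div ((hb.mono hVΩ).add
      ((hdisc.mono hVΩ).sqrt fun x hx ↦ (mem_Ioi.1 hx.2.2).ne')) fun x hx ↦ (hpos x hx).ne'
  · have hsq : √(disc x) ^ 2 = b x ^ 2 - a x * d x := Real.sq_sqrt (mem_Ioi.1 hx.2.2).le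
    have hne := (hpos x hx).ne'
    field_simp
    linear_combination d x * hsq

lemma exists_null_covector_field [CompleteSpace E] (hB : IsPseudoRiemannianMetricOn B Ω) {x₀ : E}
    (hx₀ : x₀ ∈ Ω) {l m : E →L[ℝ] ℝ} (hl : l ((B x₀).inverse l) = 0)
    (hm : 0 < m ((B x₀).inverse l)) :
    ∃ (c : E → ℝ) (V : Set E), IsOpen V ∧ x₀ ∈ V ∧ ContDiffOn ℝ ∞ c V ∧ c x₀ = 0 ∧
      ∀ x ∈ V, (l + c x • m) ((B x).inverse (l + c x • m)) = 0 := by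
  have hpair (p q : E →L[ℝ] ℝ) : ContDiffOn ℝ ∞ (fun x ↦ p ((B x).inverse q)) Ω :=
    p.contDiff.comp_contDiffOn (hB.contDiffOn_inverse.clm_apply contDiffOn_const)
  have hsymm : ∀ x ∈ Ω, l ((B x).inverse m) = m ((B x).inverse l) := by
    intro x hx
    have hinv := hB.isInvertible x hx
    simpa [hinv.self_apply_inverse] using hB.symm x hx ((B x).inverse l) ((B x).inverse m)
  obtain ⟨c, V, hV, hx₀V, hVΩ, hc, hc₀, hroot⟩ :=
    exists_contDiffOn_quadratic_root hB.isOpen (hpair m m) (hpair m l) (hpair l l) hx₀ hm hl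
  refine ⟨c, V, hV, hx₀V, hc, hc₀, fun x hx ↦ ?_⟩
  simp only [add_apply, smul_apply, map_add, map_smul, smul_eq_mul, hsymm x (hVΩ hx)]
  linear_combination hroot x hx

lemma exists_isGeodesicFamily_null_on_hyperplane [FiniteDimensional ℝ E]
    (hB : IsPseudoRiemannianMetricOn B Ω) (hτ : τ e = 1) {x₀ : E} (hx₀ : x₀ ∈ Ω) (L : F ≃L[ℝ] E)
    (hL : B x₀ (L e) (L e) = 0) :
    ∃ δ > 0, ∃ (Ψ : F → E) (c : F → ℝ), c 0 = 0 ∧ IsGeodesicFamily B Ω e (flowBox τ e δ) Ψ ∧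
      ∀ y ∈ flowBox τ e δ, τ y = 0 → Ψ y = x₀ + L y ∧
        momentum B e Ψ y = B x₀ (L e) + c y • τ ∘L (L.symm : E →L[ℝ] F) ∧
        momentum B e Ψ y (fderiv ℝ Ψ y e) = 0 := by
  let l := B x₀ (L e)
  let m : E →L[ℝ] ℝ := τ ∘L (L.symm : E →L[ℝ] F)
  have hl : (B x₀).inverse l = L e := (hB.isInvertible x₀ hx₀).inverse_apply_self _
  obtain ⟨c, V, hV, hx₀V, hc, hc₀, hnull⟩ := exists_null_covector_field hB hx₀ (l := l) (m := m)
    (by rw [hl]; exact hL) (by simp [hl, m, hτ])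
  let a : F → E := fun y ↦ x₀ + L y
  have ha : ContDiff ℝ ∞ a := contDiff_const.add L.contDiff
  have ha₀ : a 0 = x₀ := by simp [a]
  have hp : ContDiffOn ℝ ∞ (fun y ↦ l + c (a y) • m) (a ⁻¹' V) :=
    contDiffOn_const.add ((hc.comp ha.contDiffOn fun _ hy ↦ hy).smul contDiffOn_const)
  obtain ⟨δ, hδ, Ψ, hΨ, hslice⟩ := exists_isGeodesicFamily hB hτ (hV.preimage ha.continuous)
    (by simpa [ha₀] using hx₀V) ha.contDiffOn hp (by simpa [ha₀] using hx₀)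
  refine ⟨δ, hδ, Ψ, c ∘ a, by simp [ha₀, hc₀], hΨ, fun y hy hτy ↦ ?_⟩
  obtain ⟨hyV, hΨy, hmom⟩ := hslice y hy hτy
  refine ⟨hΨy, hmom, ?_⟩
  have hvel := (hB.isInvertible _ (hΨ.mapsTo hy)).inverse_apply_self (fderiv ℝ Ψ y e)
  rw [← hvel, ← momentum, hmom, hΨy]
  exact hnull _ hyV

theorem exists_null_isGeodesicFamily [FiniteDimensional ℝ E] (hB : IsPseudoRiemannianMetricOn B Ω)
    (hτ : τ e = 1) {x₀ : E} (hx₀ : x₀ ∈ Ω) (L : F ≃L[ℝ] E) (hL : B x₀ (L e) (L e) = 0) :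
    ∃ δ > 0, ∃ Ψ : F → E, IsGeodesicFamily B Ω e (flowBox τ e δ) Ψ ∧ Ψ 0 = x₀ ∧
      fderiv ℝ Ψ 0 = (L : F →L[ℝ] E) ∧
      ∀ y ∈ flowBox τ e δ, ∀ w, momentum B e Ψ y (fderiv ℝ Ψ y w) = B x₀ (L e) (L w) := by
  obtain ⟨δ, hδ, Ψ, c, hc₀, hΨ, hslice⟩ := exists_isGeodesicFamily_null_on_hyperplane hB hτ hx₀ L hL
  obtain ⟨hΨ₀, hmom₀, -⟩ := hslice 0 (zero_mem_flowBox hδ) (map_zero τ)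
  rw [map_zero, add_zero] at hΨ₀
  rw [hc₀, zero_smul, add_zero, momentum, hΨ₀] at hmom₀
  have htransverse : ∀ y ∈ flowBox τ e δ, τ y = 0 → ∀ w, τ w = 0 → fderiv ℝ Ψ y w = L w := by
    intro y hy hτy w hτw
    have ha : HasFDerivAt (fun y ↦ x₀ + L y) (L : F →L[ℝ] E) y := L.hasFDerivAt.const_add x₀
    rw [fderiv_apply_eq_of_eqOn_hyperplane (isOpen_flowBox δ) (fun z hz hτz ↦ (hslice z hz hτz).1)
      hy hτy hτw (hΨ.differentiableAt hy) ha.differentiableAt, ha.fderiv]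
    rfl
  refine ⟨δ, hδ, Ψ, hΨ, hΨ₀, ?_, fun y hy w ↦ ?_⟩
  · ext w
    rw [← projKer_add_smul (τ := τ) (e := e) w, map_add, map_smul,
      htransverse 0 (zero_mem_flowBox hδ) (map_zero τ) _ (apply_projKer hτ w),
      (hB.isInvertible x₀ hx₀).injective hmom₀]
    simp
  · have hy' := projKer_mem_flowBox hτ hy
    have hτy := apply_projKer hτ y
    obtain ⟨-, hmom, hnull⟩ := hslice _ hy' hτy
    rw [hΨ.momentum_apply_fderiv hB hτ (fun z hz hτz ↦ (hslice z hz hτz).2.2) hy,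
      ← projKer_add_smul (τ := τ) (e := e) w, map_add, map_smul, map_add, map_smul, hnull,
      htransverse _ hy' hτy _ (apply_projKer hτ w), hmom]
    simp [hL, apply_projKer hτ]

end NullGeodesicFamilies

lemma IsGeodesicFamily.eventually_apply_smul_eq {E F : Type*} [NormedAddCommGroup E]
    [NormedSpace ℝ E] [CompleteSpace E] [NormedAddCommGroup F] [NormedSpace ℝ F]
    {B : E → E →L[ℝ] E →L[ℝ] ℝ} {Ω : Set E} {e : F} {N : Set F} {Ψ : F → E}
    (hΨ : IsGeodesicFamily B Ω e N Ψ) (hB : IsPseudoRiemannianMetricOn B Ω) (h0N : 0 ∈ N)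
    {x v : ℝ → E} {t₀ : ℝ} (hx : Ψ 0 = x t₀) (hv : fderiv ℝ Ψ 0 e = v t₀)
    (hxv : ∀ᶠ t in 𝓝 t₀, HasDerivAt (fun t ↦ (x t, B (x t) (v t)))
      (cogeodesicField B (x t, B (x t) (v t))) t) :
    ∀ᶠ t : ℝ in 𝓝 0, Ψ (t • e) = x (t₀ + t) := by
  have hN : ∀ᶠ t : ℝ in 𝓝 0, t • e ∈ N := by
    have : ContinuousAt (fun t : ℝ ↦ t • e) 0 := by fun_prop
    exact this (hΨ.isOpen.mem_nhds (by simpa using h0N))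
  have hshift : Tendsto (fun t : ℝ ↦ t₀ + t) (𝓝 0) (𝓝 t₀) :=
    Continuous.tendsto' (by fun_prop) _ _ (add_zero t₀)
  have hfield : ContDiffAt ℝ 1 (cogeodesicField B) (Ψ 0, momentum B e Ψ 0) :=
    ((hB.contDiffOn_cogeodesicField).contDiffAt
      ((hB.isOpen.prod isOpen_univ).mem_nhds ⟨hΨ.mapsTo h0N, mem_univ _⟩)).of_le (by simp)
  have hunique := eventuallyEq_of_hasDerivAt_of_contDiffAt (t₀ := 0)
    (u := fun t : ℝ ↦ (Ψ (t • e), momentum B e Ψ (t • e)))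
    (z := fun t ↦ (x (t₀ + t), B (x (t₀ + t)) (v (t₀ + t)))) (by simpa using hfield)
    (hN.mono fun t ht ↦ hΨ.hasDerivAt_momentum hB ht)
    ((hshift.eventually hxv).mono fun t ht ↦ ht.comp_const_add t₀ t) (by simp [momentum, hx, hv])
  exact hunique.mono fun t ht ↦ congrArg Prod.fst ht

theorem exists_local_null_coordinates {E F : Type*} [NormedAddCommGroup E] [NormedSpace ℝ E]
    [FiniteDimensional ℝ E] [NormedAddCommGroup F] [NormedSpace ℝ F] [CompleteSpace F]
    {B : E → E →L[ℝ] E →L[ℝ] ℝ} {Ω : Set E} (hB : IsPseudoRiemannianMetricOn B Ω)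
    {τ : F →L[ℝ] ℝ} {e : F} (hτ : τ e = 1) {x v : ℝ → E} {t₀ : ℝ} (hx₀ : x t₀ ∈ Ω)
    (hnull : B (x t₀) (v t₀) (v t₀) = 0)
    (hxv : ∀ᶠ t in 𝓝 t₀, HasDerivAt (fun t ↦ (x t, B (x t) (v t)))
      (cogeodesicField B (x t, B (x t) (v t))) t)
    (L : F ≃L[ℝ] E) (hL : L e = v t₀) :
    ∃ (ψ : OpenPartialHomeomorph F E), ∃ r > 0, ψ.source = Metric.ball 0 r ∧ ψ.target ⊆ Ω ∧
      ContDiffOn ℝ ∞ ψ ψ.source ∧ ContDiffOn ℝ ∞ ψ.symm ψ.target ∧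
      (∀ y ∈ ψ.source, ∀ w,
        B (ψ y) (fderiv ℝ ψ y e) (fderiv ℝ ψ y w) = B (x t₀) (v t₀) (L w)) ∧
      ∀ t : ℝ, t • e ∈ ψ.source → ψ (t • e) = x (t₀ + t) := by
  obtain ⟨δ, hδ, Ψ, hΨ, hΨ₀, hdΨ₀, hpair⟩ :=
    exists_null_isGeodesicFamily hB hτ hx₀ L (by rwa [hL])
  have h0 := zero_mem_flowBox (τ := τ) (e := e) hδ
  obtain ⟨ψ, h0ψ, hψ, hψΨ, hψsymm⟩ := exists_openPartialHomeomorph_of_contDiffOn hΨ.isOpen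
    hΨ.contDiffOn h0 L (hdΨ₀ ▸ (hΨ.differentiableAt h0).hasFDerivAt)
  obtain ⟨ε, hε, hcurve⟩ := Metric.eventually_nhds_iff_ball.1
    (hΨ.eventually_apply_smul_eq hB h0 hΨ₀ (by simpa [hdΨ₀] using hL) hxv)
  have he : 0 < ‖e‖ := norm_pos_iff.2 fun he ↦ by simp [he] at hτ
  obtain ⟨r, hr, hball⟩ := Metric.mem_nhds_iff.1 (ψ.open_source.mem_nhds h0ψ)
  let ψ' := ψ.restrOpen (Metric.ball 0 (min r (ε * ‖e‖))) Metric.isOpen_ball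
  have hsource : ψ'.source = Metric.ball 0 (min r (ε * ‖e‖)) :=
    inter_eq_right.2 ((Metric.ball_subset_ball (min_le_left _ _)).trans hball)
  have hψ' : (ψ' : F → E) = Ψ := funext hψΨ
  have hbox : ψ'.source ⊆ flowBox τ e δ := fun y hy ↦ hψ hy.1
  refine ⟨ψ', min r (ε * ‖e‖), by positivity, hsource, fun y hy ↦ ?_, ?_,
    hψsymm.mono fun y hy ↦ hy.1, fun y hy w ↦ ?_, fun t ht ↦ ?_⟩
  · rw [← ψ'.right_inv hy, hψ']
    exact hΨ.mapsTo (hbox (ψ'.map_target hy))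
  · exact hψ' ▸ hΨ.contDiffOn.mono hbox
  · rw [hψ', ← hL]
    exact hpair y (hbox hy) w
  · rw [hψ']
    refine hcurve t (mem_ball_zero_iff.2 (lt_of_mul_lt_mul_right ?_ he.le))
    rw [hsource, mem_ball_zero_iff, norm_smul] at ht
    exact ht.trans_le (min_le_right _ _)

section LorentzForms

variable {E F : Type*} [NormedAddCommGroup E] [NormedSpace ℝ E] [NormedAddCommGroup F]
  [NormedSpace ℝ F] {β : E →L[ℝ] E →L[ℝ] ℝ}

/-- `β` is a Lorentzian scalar product: it has an orthonormal basis with exactly one timelike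
vector. This is the pointwise condition in `LorentzianMetric`. -/
def IsLorentzForm (β : E →L[ℝ] E →L[ℝ] ℝ) : Prop :=
  ∃ (n : ℕ) (b : Basis (Fin n) ℝ E) (i₀ : Fin n),
    ∀ i j, β (b i) (b j) = if i = j then (if i = i₀ then -1 else 1) else 0

namespace IsLorentzForm

lemma bilinearComp_equiv (hβ : IsLorentzForm β) (L : F ≃L[ℝ] E) :
    IsLorentzForm (β.bilinearComp (L : F →L[ℝ] E) (L : F →L[ℝ] E)) := by
  obtain ⟨n, b, i₀, hb⟩ := hβ
  exact ⟨n, b.map L.symm.toLinearEquiv, i₀, fun i j ↦ by simp [hb]⟩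

lemma symm (hβ : IsLorentzForm β) (v w : E) : β v w = β w v := by
  obtain ⟨n, b, i₀, hb⟩ := hβ
  have h : β.toBilinForm.IsSymm := (LinearMap.BilinForm.isSymm_iff_basis b).2 fun i j ↦ by
    simp only [ContinuousLinearMap.toBilinForm_apply, hb, eq_comm (a := j)]
    split_ifs <;> simp_all
  exact h.eq v w

lemma exists_basis_apply_eq_repr (hβ : IsLorentzForm β) :
    ∃ (n : ℕ) (b : Basis (Fin n) ℝ E) (i₀ : Fin n), ∀ v i,
      β v (b i) = (if i = i₀ then -1 else 1) * b.repr v i := by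
  obtain ⟨n, b, i₀, hb⟩ := hβ
  refine ⟨n, b, i₀, fun v i ↦ ?_⟩
  conv_lhs => rw [← b.sum_repr v]
  simp only [map_sum, map_smul, sum_apply, smul_apply, hb, smul_eq_mul, mul_ite, mul_zero,
    Finset.sum_ite_eq', Finset.mem_univ, if_true]
  split_ifs <;> ring

lemma isInvertible (hβ : IsLorentzForm β) : β.IsInvertible := by
  obtain ⟨n, b, i₀, hb⟩ := hβ.exists_basis_apply_eq_repr
  have : FiniteDimensional ℝ E := b.finiteDimensional_of_finite
  have hinj : Function.Injective β.toLinearMap := by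
    refine (injective_iff_map_eq_zero β.toLinearMap).2 fun v hv ↦ b.ext_elem fun i ↦ ?_
    have hvi : β v (b i) = 0 := DFunLike.congr_fun hv (b i)
    rw [hb] at hvi
    split_ifs at hvi <;> simpa using hvi
  have hrank : finrank ℝ E = finrank ℝ (E →L[ℝ] ℝ) :=
    (Subspace.dual_finrank_eq (K := ℝ)).symm.trans LinearMap.toContinuousLinearMap.finrank_eq
  exact ⟨(LinearEquiv.ofInjectiveOfFinrankEq β.toLinearMap hinj hrank).toContinuousLinearEquiv,
    by ext; rfl⟩

lemma apply_self_pos (hβ : IsLorentzForm β) {k w : E} (hk : β k k = 0) (hk₀ : k ≠ 0)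
    (hw : β k w = 0) (hwk : w ∉ Submodule.span ℝ {k}) : 0 < β w w := by
  obtain ⟨n, b, i₀, hb⟩ := hβ.exists_basis_apply_eq_repr
  have hpos : ∀ v, b.repr v i₀ = 0 → v ≠ 0 → 0 < β v v := by
    intro v hv₀ hv
    have hsum : β v v = ∑ i, b.repr v i ^ 2 := by
      conv_lhs => rw [← b.sum_repr v]
      rw [map_sum, b.sum_repr]
      refine Finset.sum_congr rfl fun i _ ↦ ?_
      rw [map_smul, hb, smul_eq_mul]
      split_ifs with hi
      · simp [hi, hv₀]
      · ring
    rw [hsum]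
    refine (Finset.sum_nonneg fun i _ ↦ sq_nonneg _).lt_of_ne' fun h ↦ hv (b.ext_elem fun i ↦ ?_)
    simpa using (Finset.sum_eq_zero_iff_of_nonneg fun i _ ↦ sq_nonneg _).1 h i (Finset.mem_univ i)
  have hk₁ : b.repr k i₀ ≠ 0 := fun h ↦ (hpos k h hk₀).ne' hk
  set c := b.repr w i₀ / b.repr k i₀
  -- Subtracting a multiple of `k` from `w` changes neither `β w w` nor `w` modulo `k`.
  have hsub : β (w - c • k) (w - c • k) = β w w := by simp [hk, hw, hβ.symm w k]
  rw [← hsub]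
  refine hpos _ (by simp [c, hk₁]) fun h ↦ hwk ?_
  exact Submodule.mem_span_singleton.2 ⟨c, (sub_eq_zero.1 h).symm⟩

lemma posDef_of_null {ι : Type*} [Finite ι] (hβ : IsLorentzForm β) {k : E} (hk : β k k = 0)
    {w : ι → E} (hw : ∀ i, β k (w i) = 0) (hli : LinearIndependent ℝ w)
    (hkw : k ∉ Submodule.span ℝ (range w)) :
    (Matrix.of fun i j ↦ β (w i) (w j)).PosDef := by
  have := Fintype.ofFinite ι
  refine .of_dotProduct_mulVec_pos (by ext i j; exact hβ.symm _ _) fun x hx ↦ ?_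
  have hsum : star x ⬝ᵥ (Matrix.of fun i j ↦ β (w i) (w j)).mulVec x =
      β (∑ i, x i • w i) (∑ i, x i • w i) := by
    simp only [dotProduct, Matrix.mulVec, Matrix.of_apply, star_trivial, map_sum, map_smul,
      sum_apply, smul_apply, smul_eq_mul, Finset.mul_sum]
    rw [Finset.sum_comm]
    exact Finset.sum_congr rfl fun i _ ↦ Finset.sum_congr rfl fun j _ ↦ by ring
  rw [hsum]
  refine hβ.apply_self_pos hk (fun h ↦ hkw (h ▸ Submodule.zero_mem _))
    (by simp only [map_sum, map_smul, hw, smul_zero, Finset.sum_const_zero]) fun h ↦ ?_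
  obtain ⟨c, hc⟩ := Submodule.mem_span_singleton.1 h
  have hspan : c • k ∈ Submodule.span ℝ (range w) := hc ▸ Submodule.sum_mem _ fun i _ ↦
    Submodule.smul_mem _ _ (Submodule.subset_span (mem_range_self i))
  have hc₀ : c = 0 := by_contra fun hc₀ ↦ hkw ((Submodule.smul_mem_iff _ hc₀).1 hspan)
  rw [hc₀, zero_smul] at hc
  exact hx (funext (Fintype.linearIndependent_iff.1 hli x hc.symm))

end IsLorentzForm

end LorentzForms

section AdaptedEquiv

variable {E F : Type*} [NormedAddCommGroup E] [NormedSpace ℝ E] [NormedAddCommGroup F]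
  [NormedSpace ℝ F]

lemma exists_equiv_prod_ker {f : E →L[ℝ] ℝ} (hf : f ≠ 0) :
    ∃ Φ : E ≃L[ℝ] ℝ × f.ker, (∀ v, (Φ v).1 = f v) ∧ ∀ v : f.ker, Φ v = (0, v) := by
  obtain ⟨a, ha⟩ := ContinuousLinearMap.exists_ne_zero hf
  refine ⟨ContinuousLinearEquiv.equivOfRightInverse f
    (ContinuousLinearMap.toSpanSingleton ℝ ((f a)⁻¹ • a)) fun c ↦ by simp [ha], fun v ↦ rfl, ?_⟩
  intro v
  ext <;> simp

lemma exists_equiv_apply_eq_comp_eq [FiniteDimensional ℝ E] [FiniteDimensional ℝ F]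
    (hfin : finrank ℝ F = finrank ℝ E) {f : E →L[ℝ] ℝ} {η : F →L[ℝ] ℝ} {y : E} {x : F}
    (hf : f ≠ 0) (hη : η ≠ 0) (hy : y ≠ 0) (hx : x ≠ 0) (hfy : f y = 0) (hηx : η x = 0) :
    ∃ L : F ≃L[ℝ] E, L x = y ∧ ∀ w, f (L w) = η w := by
  obtain ⟨Φ, hΦ, hΦx⟩ := exists_equiv_prod_ker hη
  obtain ⟨Ψ, hΨ, hΨy⟩ := exists_equiv_prod_ker hf
  have hker : finrank ℝ η.ker = finrank ℝ f.ker := by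
    have h := (Φ.symm.toLinearEquiv.finrank_eq.trans hfin).trans Ψ.toLinearEquiv.finrank_eq
    simpa only [finrank_prod, add_right_inj] using h
  let A₀ : η.ker ≃L[ℝ] f.ker := .ofFinrankEq hker
  obtain ⟨A₁, hA₁⟩ := SeparatingDual.exists_continuousLinearEquiv_apply_eq (R := ℝ)
    (x := A₀ ⟨x, hηx⟩) (y := (⟨y, hfy⟩ : f.ker))
    (by simpa [← Subtype.val_inj] using hx) (by simpa [← Subtype.val_inj] using hy)
  refine ⟨(Φ.trans ((ContinuousLinearEquiv.refl ℝ ℝ).prodCongr (A₀.trans A₁))).trans Ψ.symm,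
    ?_, fun w ↦ ?_⟩
  · rw [← Ψ.injective.eq_iff, hΨy ⟨y, hfy⟩, ← hA₁]
    simp [hΦx ⟨x, hηx⟩]
  · rw [← hΨ]
    simp [hΦ]

end AdaptedEquiv

section ChartCalculus

variable {n : ℕ} {M : Type*} [TopologicalSpace M] [ChartedSpace (EuclideanSpace ℝ (Fin n)) M]
  {φ : OpenPartialHomeomorph M (EuclideanSpace ℝ (Fin n))} {p : M} {y : EuclideanSpace ℝ (Fin n)}

/-- The differential of the chart `φ` at `p`, with the tangent space at `p` read as the model
space. -/
def chartDeriv (φ : OpenPartialHomeomorph M (EuclideanSpace ℝ (Fin n))) (p : M) :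
    EuclideanSpace ℝ (Fin n) →L[ℝ] EuclideanSpace ℝ (Fin n) :=
  mfderiv (𝓡 n) (𝓡 n) φ p

/-- The differential of the inverse of the chart `φ` at `y`, with the tangent space at `φ.symm y`
read as the model space. -/
def chartSymmDeriv (φ : OpenPartialHomeomorph M (EuclideanSpace ℝ (Fin n)))
    (y : EuclideanSpace ℝ (Fin n)) : EuclideanSpace ℝ (Fin n) →L[ℝ] EuclideanSpace ℝ (Fin n) :=
  mfderiv (𝓡 n) (𝓡 n) φ.symm y

namespace IsSmoothChart

lemma mdifferentiable (hφ : IsSmoothChart φ) : φ.MDifferentiable (𝓡 n) (𝓡 n) :=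
  ⟨(contMDiffOn_of_mem_maximalAtlas hφ).mdifferentiableOn (by simp),
    (contMDiffOn_symm_of_mem_maximalAtlas hφ).mdifferentiableOn (by simp)⟩

lemma exists_equiv_chartDeriv (hφ : IsSmoothChart φ) (hp : p ∈ φ.source) :
    ∃ L : EuclideanSpace ℝ (Fin n) ≃L[ℝ] EuclideanSpace ℝ (Fin n),
      L = chartDeriv φ p ∧ L.symm = chartSymmDeriv φ (φ p) :=
  ⟨hφ.mdifferentiable.mfderiv hp, rfl, rfl⟩

lemma chartSymmDeriv_chartDeriv (hφ : IsSmoothChart φ) (hp : p ∈ φ.source)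
    (v : EuclideanSpace ℝ (Fin n)) : chartSymmDeriv φ (φ p) (chartDeriv φ p v) = v := by
  obtain ⟨L, hL, hL'⟩ := hφ.exists_equiv_chartDeriv hp
  simp [← hL, ← hL']

lemma coordField_eq (hφ : IsSmoothChart φ) (hp : p ∈ φ.source) (i : Fin n) :
    coordField φ i p = chartSymmDeriv φ (φ p) (EuclideanSpace.single i 1) := by
  obtain ⟨L, hL, hL'⟩ := hφ.exists_equiv_chartDeriv hp
  change (chartDeriv φ p).inverse _ = _
  rw [← hL, ← hL', ContinuousLinearMap.inverse_equiv]

lemma chartDeriv_velocity (hφ : IsSmoothChart φ) {γ : ℝ → M} {t : ℝ}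
    (hγ : MDifferentiableAt 𝓘(ℝ, ℝ) (𝓡 n) γ t) (ht : γ t ∈ φ.source) :
    chartDeriv φ (γ t) (velocity γ t) = deriv (fun s ↦ φ (γ s)) t := by
  have hchain := mfderiv_comp (I := 𝓘(ℝ, ℝ)) (I' := 𝓡 n) (I'' := 𝓡 n) t
    (hφ.mdifferentiable.mdifferentiableAt ht) hγ
  rw [mfderiv_eq_fderiv] at hchain
  exact (DFunLike.congr_fun hchain (1 : ℝ)).symm.trans fderiv_apply_one_eq_deriv

lemma chartSymmDeriv_trans_symm (hφ : IsSmoothChart φ)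
    {e : OpenPartialHomeomorph (EuclideanSpace ℝ (Fin n)) (EuclideanSpace ℝ (Fin n))}
    (he : DifferentiableAt ℝ e y) (hy : e y ∈ φ.target) :
    chartSymmDeriv (φ.trans e.symm) y = chartSymmDeriv φ (e y) ∘L fderiv ℝ e y := by
  have hchain := mfderiv_comp (I := 𝓡 n) (I' := 𝓡 n) (I'' := 𝓡 n) y
    (hφ.mdifferentiable.mdifferentiableAt_symm hy) he.mdifferentiableAt
  rw [mfderiv_eq_fderiv] at hchain
  exact hchain

end IsSmoothChart

variable [IsManifold (𝓡 n) ∞ M] (g : LorentzianMetric n M)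

namespace LorentzianMetric

/-- The metric at `p`, with the tangent space at `p` read as the model space. -/
def form (p : M) : EuclideanSpace ℝ (Fin n) →L[ℝ] EuclideanSpace ℝ (Fin n) →L[ℝ] ℝ :=
  g.inner p

/-- The metric in the chart `φ`, as a field of bilinear forms on coordinate space; its matrices are
those of `LorentzianMetric.gram`. -/
def coordForm (φ : OpenPartialHomeomorph M (EuclideanSpace ℝ (Fin n)))
    (y : EuclideanSpace ℝ (Fin n)) :
    EuclideanSpace ℝ (Fin n) →L[ℝ] EuclideanSpace ℝ (Fin n) →L[ℝ] ℝ :=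
  (g.form (φ.symm y)).bilinearComp (chartSymmDeriv φ y) (chartSymmDeriv φ y)

lemma coordForm_chartDeriv (hφ : IsSmoothChart φ) (hp : p ∈ φ.source)
    (v w : EuclideanSpace ℝ (Fin n)) :
    g.coordForm φ (φ p) (chartDeriv φ p v) (chartDeriv φ p w) = g.form p v w := by
  rw [coordForm, ContinuousLinearMap.bilinearComp_apply, hφ.chartSymmDeriv_chartDeriv hp,
    hφ.chartSymmDeriv_chartDeriv hp, φ.left_inv hp]

lemma gram_apply (hφ : IsSmoothChart φ) (hy : y ∈ φ.target) (i j : Fin n) :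
    g.gram φ y i j =
      g.coordForm φ y (EuclideanSpace.single i 1) (EuclideanSpace.single j 1) := by
  have hfield := hφ.coordField_eq (φ.map_target hy)
  rw [φ.right_inv hy] at hfield
  simp only [gram, Matrix.of_apply, hfield]
  rfl

lemma isLorentzForm_coordForm (hφ : IsSmoothChart φ) (hy : y ∈ φ.target) :
    IsLorentzForm (g.coordForm φ y) := by
  obtain ⟨L, -, hL⟩ := hφ.exists_equiv_chartDeriv (φ.map_target hy)
  rw [φ.right_inv hy] at hL
  rw [coordForm, ← hL]
  exact .bilinearComp_equiv ⟨n, g.signature (φ.symm y)⟩ L.symm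

lemma contDiffOn_coordForm (hφ : IsSmoothChart φ) :
    ContDiffOn ℝ ∞ (g.coordForm φ) φ.target := by
  have hsymm := contMDiffOn_symm_of_mem_maximalAtlas hφ
  have hfield : ∀ v : EuclideanSpace ℝ (Fin n), ContMDiffOn (𝓡 n) (𝓡 n).tangent ∞
      (fun y ↦ (TotalSpace.mk' (EuclideanSpace ℝ (Fin n)) (φ.symm y) (chartSymmDeriv φ y v) :
        TangentBundle (𝓡 n) M)) φ.target := by
    intro v
    have hconst := (contMDiff_vectorSpace_iff_contDiff (𝕜 := ℝ) (E := EuclideanSpace ℝ (Fin n))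
      (n := ∞) (V := fun _ ↦ v)).2 contDiff_const
    refine ((hsymm.contMDiffOn_tangentMapWithin (m := ∞) (by simp)
      φ.open_target.uniqueMDiffOn).comp (s := φ.target) hconst.contMDiffOn fun y hy ↦ hy).congr
        fun y hy ↦ ?_
    simp only [Function.comp, tangentMapWithin]
    rw [mfderivWithin_of_isOpen φ.open_target hy]
    rfl
  refine contDiffOn_clm_apply.2 fun v ↦ contDiffOn_clm_apply.2 fun w ↦ ?_
  have hsection := (g.contMDiff.comp_contMDiffOn hsymm).clm_bundle_apply₂
    (F₃ := ℝ) (E₃ := Trivial M ℝ) (hfield v) (hfield w)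
  rw [← contMDiffOn_iff_contDiffOn]
  exact fun y hy ↦ (contMDiffWithinAt_totalSpace.1 (hsection y hy)).2

lemma isPseudoRiemannianMetricOn_coordForm (hφ : IsSmoothChart φ) :
    IsPseudoRiemannianMetricOn (g.coordForm φ) φ.target where
  isOpen := φ.open_target
  contDiffOn := g.contDiffOn_coordForm hφ
  symm _ hy := (g.isLorentzForm_coordForm hφ hy).symm
  isInvertible _ hy := (g.isLorentzForm_coordForm hφ hy).isInvertible

end LorentzianMetric

variable {e : OpenPartialHomeomorph (EuclideanSpace ℝ (Fin n)) (EuclideanSpace ℝ (Fin n))}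

lemma IsSmoothChart.trans_symm (hφ : IsSmoothChart φ) (he : ContDiffOn ℝ ∞ e e.source)
    (he' : ContDiffOn ℝ ∞ e.symm e.target) : IsSmoothChart (φ.trans e.symm) := by
  refine OpenPartialHomeomorph.mem_maximalAtlas_of_contMDiffOn _ ?_ ?_
  · exact he'.contMDiffOn.comp ((contMDiffOn_of_mem_maximalAtlas hφ).mono fun p hp ↦ hp.1)
      fun p hp ↦ hp.2
  · exact (contMDiffOn_symm_of_mem_maximalAtlas hφ).comp
      (he.contMDiffOn.mono fun y hy ↦ hy.1) fun y hy ↦ hy.2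

lemma LorentzianMetric.coordForm_trans_symm (hφ : IsSmoothChart φ)
    (he : DifferentiableAt ℝ e y) (hy : e y ∈ φ.target) (v w : EuclideanSpace ℝ (Fin n)) :
    g.coordForm (φ.trans e.symm) y v w =
      g.coordForm φ (e y) (fderiv ℝ e y v) (fderiv ℝ e y w) := by
  rw [coordForm, hφ.chartSymmDeriv_trans_symm he hy]
  rfl

end ChartCalculus

section Christoffel

variable {n : ℕ} {F : Type*} [NormedAddCommGroup F] [NormedSpace ℝ F]

lemma apply_eq_sum_single (f : EuclideanSpace ℝ (Fin n) →L[ℝ] F) (v : EuclideanSpace ℝ (Fin n)) :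
    f v = ∑ i, v i • f (EuclideanSpace.single i 1) := by
  conv_lhs => rw [← (EuclideanSpace.basisFun (Fin n) ℝ).sum_repr v]
  simp

lemma apply₂_eq_sum_single
    (f : EuclideanSpace ℝ (Fin n) →L[ℝ] EuclideanSpace ℝ (Fin n) →L[ℝ] F)
    (v w : EuclideanSpace ℝ (Fin n)) :
    f v w = ∑ i, ∑ j, (v i * w j) • f (EuclideanSpace.single i 1) (EuclideanSpace.single j 1) := by
  rw [apply_eq_sum_single f v, sum_apply]
  refine Finset.sum_congr rfl fun i _ ↦ ?_
  rw [smul_apply, apply_eq_sum_single _ w, Finset.smul_sum]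
  exact Finset.sum_congr rfl fun j _ ↦ smul_smul _ _ _

lemma eq_of_apply_single_eq {f h : EuclideanSpace ℝ (Fin n) →L[ℝ] F}
    (hfh : ∀ i, f (EuclideanSpace.single i 1) = h (EuclideanSpace.single i 1)) : f = h := by
  ext v
  rw [apply_eq_sum_single f, apply_eq_sum_single h]
  simp only [hfh]

lemma isUnit_det_of_isInvertible
    {β : EuclideanSpace ℝ (Fin n) →L[ℝ] EuclideanSpace ℝ (Fin n) →L[ℝ] ℝ} (hβ : β.IsInvertible) :
    IsUnit (Matrix.of fun i j ↦
      β (EuclideanSpace.single i 1) (EuclideanSpace.single j 1)).det := by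
  rw [isUnit_iff_ne_zero, Ne, ← Matrix.exists_vecMul_eq_zero_iff]
  rintro ⟨c, hc, hc₀⟩
  refine hc (congrArg WithLp.ofLp (hβ.injective ?_ : WithLp.toLp 2 c = 0))
  rw [map_zero]
  refine eq_of_apply_single_eq fun j ↦ ?_
  rw [apply_eq_sum_single β, sum_apply]
  exact congrFun hc₀ j

variable {M : Type*} [TopologicalSpace M] [ChartedSpace (EuclideanSpace ℝ (Fin n)) M]
  [IsManifold (𝓡 n) ∞ M] {φ : OpenPartialHomeomorph M (EuclideanSpace ℝ (Fin n))}
  {y : EuclideanSpace ℝ (Fin n)}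

namespace LorentzianMetric

variable (g : LorentzianMetric n M)

lemma partialDeriv_gram (hφ : IsSmoothChart φ) (hy : y ∈ φ.target) (k i j : Fin n) :
    partialDeriv k (fun z ↦ g.gram φ z i j) y =
      fderiv ℝ (g.coordForm φ) y (EuclideanSpace.single k 1) (EuclideanSpace.single i 1)
        (EuclideanSpace.single j 1) := by
  have hgram : (fun z ↦ g.gram φ z i j) =ᶠ[𝓝 y] fun z ↦
      g.coordForm φ z (EuclideanSpace.single i 1) (EuclideanSpace.single j 1) := by
    filter_upwards [φ.open_target.mem_nhds hy] with z hz using g.gram_apply hφ hz i j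
  have hform : DifferentiableAt ℝ (g.coordForm φ) y :=
    ((g.contDiffOn_coordForm hφ).contDiffAt (φ.open_target.mem_nhds hy)).differentiableAt (by simp)
  rw [partialDeriv, hgram.fderiv_eq, fderiv_clm_apply (by fun_prop) (by fun_prop),
    fderiv_clm_apply hform (by fun_prop)]
  simp

lemma sum_gram_mul_christoffel (hφ : IsSmoothChart φ) (hy : y ∈ φ.target) (i j l : Fin n) :
    ∑ k, g.gram φ y l k * g.christoffel φ k i j y = 1 / 2 *
      (partialDeriv i (fun z ↦ g.gram φ z j l) y + partialDeriv j (fun z ↦ g.gram φ z i l) y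
        - partialDeriv l (fun z ↦ g.gram φ z i j) y) := by
  set c : Fin n → ℝ := fun l ↦ partialDeriv i (fun z ↦ g.gram φ z j l) y
    + partialDeriv j (fun z ↦ g.gram φ z i l) y - partialDeriv l (fun z ↦ g.gram φ z i j) y
  have hdet : IsUnit (g.gram φ y).det := by
    convert isUnit_det_of_isInvertible (g.isLorentzForm_coordForm hφ hy).isInvertible
    ext i j
    exact g.gram_apply hφ hy i j
  have hinv : (g.gram φ y).mulVec ((g.gram φ y)⁻¹.mulVec c) = c := by
    rw [Matrix.mulVec_mulVec, Matrix.mul_nonsing_inv _ hdet, Matrix.one_mulVec]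
  calc ∑ k, g.gram φ y l k * g.christoffel φ k i j y
      = ∑ k, 1 / 2 * (g.gram φ y l k * ((g.gram φ y)⁻¹.mulVec c) k) :=
        Finset.sum_congr rfl fun k _ ↦ mul_left_comm _ _ _
    _ = 1 / 2 * c l := by rw [← Finset.mul_sum]; exact congrArg _ (congrFun hinv l)

/-- The vector `Γ(v, v)` at the point `y` of coordinate space. -/
def christoffelVec (φ : OpenPartialHomeomorph M (EuclideanSpace ℝ (Fin n)))
    (y v : EuclideanSpace ℝ (Fin n)) : EuclideanSpace ℝ (Fin n) :=
  WithLp.toLp 2 fun k ↦ ∑ i, ∑ j, g.christoffel φ k i j y * v i * v j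

lemma coordForm_christoffelVec (hφ : IsSmoothChart φ) (hy : y ∈ φ.target)
    (v : EuclideanSpace ℝ (Fin n)) :
    g.coordForm φ y (g.christoffelVec φ y v) = fderiv ℝ (g.coordForm φ) y v v -
      (1 / 2 : ℝ) • ((fderiv ℝ (g.coordForm φ) y).flip v).flip v := by
  set T := fderiv ℝ (g.coordForm φ) y with hT
  refine eq_of_apply_single_eq fun l ↦ ?_
  have hΓ : g.coordForm φ y (g.christoffelVec φ y v) (EuclideanSpace.single l 1) =
      ∑ i, ∑ j, v i * v j * ∑ k, g.gram φ y l k * g.christoffel φ k i j y := by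
    rw [(g.isLorentzForm_coordForm hφ hy).symm, apply_eq_sum_single]
    simp only [christoffelVec, ← g.gram_apply hφ hy, smul_eq_mul, Finset.sum_mul, Finset.mul_sum]
    rw [Finset.sum_comm]
    refine Finset.sum_congr rfl fun i _ ↦ ?_
    rw [Finset.sum_comm]
    exact Finset.sum_congr rfl fun j _ ↦ Finset.sum_congr rfl fun k _ ↦ by ring
  have hflip : T v v (EuclideanSpace.single l 1) = ∑ i, ∑ j, v i * v j *
      T (EuclideanSpace.single j 1) (EuclideanSpace.single i 1) (EuclideanSpace.single l 1) := by
    rw [← T.flip_apply, apply₂_eq_sum_single T.flip]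
    simp
  have hT' : T v v (EuclideanSpace.single l 1) = ∑ i, ∑ j, v i * v j *
      T (EuclideanSpace.single i 1) (EuclideanSpace.single j 1) (EuclideanSpace.single l 1) := by
    rw [apply₂_eq_sum_single T]
    simp
  have hTl : T (EuclideanSpace.single l 1) v v = ∑ i, ∑ j, v i * v j *
      T (EuclideanSpace.single l 1) (EuclideanSpace.single i 1) (EuclideanSpace.single j 1) :=
    apply₂_eq_sum_single _ v v
  calc g.coordForm φ y (g.christoffelVec φ y v) (EuclideanSpace.single l 1)
      = 1 / 2 * (T v v (EuclideanSpace.single l 1) + T v v (EuclideanSpace.single l 1)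
          - T (EuclideanSpace.single l 1) v v) := by
        rw [hΓ]
        nth_rw 1 [hT']
        rw [hflip, hTl]
        simp only [g.sum_gram_mul_christoffel hφ hy, g.partialDeriv_gram hφ hy, ← hT,
          ← Finset.sum_add_distrib, ← Finset.sum_sub_distrib, Finset.mul_sum]
        exact Finset.sum_congr rfl fun i _ ↦ Finset.sum_congr rfl fun j _ ↦ by ring
    _ = _ := by
        simp only [sub_apply, smul_apply, ContinuousLinearMap.flip_apply, smul_eq_mul]
        ring

end LorentzianMetric

end Christoffel

section GeodesicEquation

lemma hasDerivAt_cogeodesicField_of_apply_eq {E : Type*} [NormedAddCommGroup E] [NormedSpace ℝ E]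
    {B : E → E →L[ℝ] E →L[ℝ] ℝ} {Ω : Set E} (hB : IsPseudoRiemannianMetricOn B Ω) {x v : ℝ → E}
    {t : ℝ} {a : E} (hxΩ : x t ∈ Ω) (hx : HasDerivAt x (v t) t) (hv : HasDerivAt v a t)
    (ha : B (x t) a = (1 / 2 : ℝ) • ((fderiv ℝ B (x t)).flip (v t)).flip (v t) -
      fderiv ℝ B (x t) (v t) (v t)) :
    HasDerivAt (fun s ↦ (x s, B (x s) (v s))) (cogeodesicField B (x t, B (x t) (v t))) t := by
  have hBx : HasFDerivAt B (fderiv ℝ B (x t)) (x t) :=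
    ((hB.contDiffOn.contDiffAt (hB.isOpen.mem_nhds hxΩ)).differentiableAt (by simp)).hasFDerivAt
  rw [cogeodesicField_momentum (hB.isInvertible _ hxΩ)]
  refine (hx.prodMk ((hBx.comp_hasDerivAt t hx).clm_apply hv)).congr_deriv ?_
  simp [ha]

variable {n : ℕ} {M : Type*} [TopologicalSpace M] [ChartedSpace (EuclideanSpace ℝ (Fin n)) M]
  [IsManifold (𝓡 n) ∞ M] {φ : OpenPartialHomeomorph M (EuclideanSpace ℝ (Fin n))}
  {g : LorentzianMetric n M} {γ : ℝ → M} {D : Set ℝ} {t : ℝ}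

lemma deriv_apply_coord {f : ℝ → EuclideanSpace ℝ (Fin n)} (hf : DifferentiableAt ℝ f t)
    (k : Fin n) : deriv (fun s ↦ f s k) t = deriv f t k :=
  ((EuclideanSpace.proj (𝕜 := ℝ) k).hasFDerivAt.comp_hasDerivAt t hf.hasDerivAt).deriv

namespace LorentzianMetric.IsGeodesicOn

lemma isOpen_inter_preimage (hγ : g.IsGeodesicOn γ D) : IsOpen (D ∩ γ ⁻¹' φ.source) :=
  hγ.contMDiffOn.continuousOn.isOpen_inter_preimage hγ.isOpen φ.open_source

lemma contDiffOn_chart_comp (hγ : g.IsGeodesicOn γ D) (hφ : IsSmoothChart φ) :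
    ContDiffOn ℝ ∞ (fun s ↦ φ (γ s)) (D ∩ γ ⁻¹' φ.source) := by
  rw [← contMDiffOn_iff_contDiffOn]
  exact (contMDiffOn_of_mem_maximalAtlas hφ).comp (hγ.contMDiffOn.mono inter_subset_left)
    fun s hs ↦ hs.2

lemma deriv_deriv_eq_neg_christoffelVec (hγ : g.IsGeodesicOn γ D) (hφ : IsSmoothChart φ)
    (ht : t ∈ D) (htφ : γ t ∈ φ.source) :
    deriv (deriv fun s ↦ φ (γ s)) t =
      -g.christoffelVec φ (φ (γ t)) (deriv (fun s ↦ φ (γ s)) t) := by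
  have hopen := hγ.isOpen_inter_preimage (φ := φ)
  have hx := hγ.contDiffOn_chart_comp hφ
  have hx' : ∀ s ∈ D ∩ γ ⁻¹' φ.source, DifferentiableAt ℝ (fun s ↦ φ (γ s)) s := fun s hs ↦
    (hx.contDiffAt (hopen.mem_nhds hs)).differentiableAt (by simp)
  have hx'' : DifferentiableAt ℝ (deriv fun s ↦ φ (γ s)) t :=
    ((hx.deriv_of_isOpen hopen (m := ∞) (by simp)).contDiffAt
      (hopen.mem_nhds ⟨ht, htφ⟩)).differentiableAt (by simp)
  ext k
  have hvel : (deriv fun s ↦ φ (γ s) k) =ᶠ[𝓝 t] fun s ↦ deriv (fun s ↦ φ (γ s)) s k := by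
    filter_upwards [hopen.mem_nhds ⟨ht, htφ⟩] with s hs using deriv_apply_coord (hx' s hs) k
  have hgeo := hγ.eq φ hφ t ht htφ k
  rw [covDerivAlong, hvel.deriv_eq, deriv_apply_coord hx''] at hgeo
  simp only [deriv_apply_coord (hx' t ⟨ht, htφ⟩)] at hgeo
  exact eq_neg_of_add_eq_zero_left hgeo

lemma hasDerivAt_cogeodesicField (hγ : g.IsGeodesicOn γ D) (hφ : IsSmoothChart φ)
    (ht : t ∈ D) (htφ : γ t ∈ φ.source) :
    HasDerivAt (fun s ↦ (φ (γ s), g.coordForm φ (φ (γ s)) (deriv (fun s ↦ φ (γ s)) s)))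
      (cogeodesicField (g.coordForm φ)
        (φ (γ t), g.coordForm φ (φ (γ t)) (deriv (fun s ↦ φ (γ s)) t))) t := by
  have hmem := hγ.isOpen_inter_preimage.mem_nhds ⟨ht, htφ⟩
  have hx := hγ.contDiffOn_chart_comp hφ
  refine hasDerivAt_cogeodesicField_of_apply_eq (g.isPseudoRiemannianMetricOn_coordForm hφ)
    (φ.map_source htφ) ((hx.contDiffAt hmem).differentiableAt (by simp)).hasDerivAt
    (((hx.deriv_of_isOpen hγ.isOpen_inter_preimage (m := ∞) (by simp)).contDiffAt
      hmem).differentiableAt (by simp)).hasDerivAt ?_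
  rw [hγ.deriv_deriv_eq_neg_christoffelVec hφ ht htφ, map_neg,
    g.coordForm_christoffelVec hφ (φ.map_source htφ), neg_sub]

end LorentzianMetric.IsGeodesicOn

end GeodesicEquation

section CoordinateLines

lemma chart_comp_eq_smul_of_image_uIcc_subset {F M : Type*} [NormedAddCommGroup F]
    [NormedSpace ℝ F] [TopologicalSpace M] {ψ : OpenPartialHomeomorph M F} {γ : ℝ → M} {t₀ t r : ℝ}
    {v : F} (hγ : ContinuousOn γ (uIcc t₀ t)) (hts : γ '' uIcc t₀ t ⊆ ψ.source) (hr : 0 < r)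
    (hv : ‖v‖ = 1) (hψ : ψ.target ⊆ Metric.ball 0 r)
    (hline : ∀ s, |s - t₀| < r → γ s ∈ ψ.source → ψ (γ s) = (s - t₀) • v) :
    ψ (γ t) = (t - t₀) • v := by
  rw [image_subset_iff] at hts
  -- Where `ψ ∘ γ` is the line, its norm is `|s - t₀|` and must be less than `r`; so the parameters
  -- at which it is the line form a subset of the interval that is both open and closed.
  have hiff : ∀ s ∈ uIcc t₀ t, ψ (γ s) - (s - t₀) • v = 0 ↔ |s - t₀| < r := fun s hs ↦ by
    refine ⟨fun h ↦ ?_, fun h ↦ sub_eq_zero.2 (hline s h (hts hs))⟩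
    have hball := hψ (ψ.map_source (hts hs))
    rwa [sub_eq_zero.1 h, mem_ball_zero_iff, norm_smul, hv, mul_one, Real.norm_eq_abs] at hball
  have hclosed : IsClosed (uIcc t₀ t ∩ (fun s ↦ ψ (γ s) - (s - t₀) • v) ⁻¹' {0}) :=
    ContinuousOn.preimage_isClosed_of_isClosed
      ((ψ.continuousOn.comp hγ hts).sub (by fun_prop)) isClosed_Icc isClosed_singleton
  refine sub_eq_zero.1 ((hiff t right_mem_uIcc).2 ?_)
  by_contra! hrt
  obtain ⟨s, hs, ⟨-, hsline⟩, hsr⟩ := isPreconnected_closed_iff.1 isPreconnected_uIcc _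
    {s | r ≤ |s - t₀|} hclosed (isClosed_le (by fun_prop) (by fun_prop))
    (fun s hs ↦ (lt_or_ge |s - t₀| r).imp_left fun h ↦ ⟨hs, (hiff s hs).2 h⟩)
    ⟨t₀, left_mem_uIcc, left_mem_uIcc, (hiff t₀ left_mem_uIcc).2 (by simpa using hr)⟩
    ⟨t, right_mem_uIcc, hrt⟩
  exact hsr.not_gt ((hiff s hs).1 hsline)

variable {n : ℕ} {M : Type*} [TopologicalSpace M] [ChartedSpace (EuclideanSpace ℝ (Fin n)) M]

lemma IsSmoothChart.isMIntegralCurveOn_coordField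
    {ψ : OpenPartialHomeomorph M (EuclideanSpace ℝ (Fin n))} (hψ : IsSmoothChart ψ) {γ : ℝ → M}
    {s : Set ℝ} (hs : MapsTo γ s ψ.source) {t₀ : ℝ} {i : Fin n}
    (h : ∀ t ∈ s, ψ (γ t) = (t - t₀) • EuclideanSpace.single i (1 : ℝ)) :
    IsMIntegralCurveOn γ (fun p ↦ coordField ψ i p) s := by
  intro t ht
  have hmem : (t - t₀) • EuclideanSpace.single i (1 : ℝ) ∈ ψ.target :=
    h t ht ▸ ψ.map_source (hs ht)
  have hcurve : ∀ u ∈ s, γ u = ψ.symm ((u - t₀) • EuclideanSpace.single i (1 : ℝ)) := fun u hu ↦ by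
    rw [← h u hu, ψ.left_inv (hs hu)]
  have hline : HasFDerivAt (fun u : ℝ ↦ (u - t₀) • EuclideanSpace.single i (1 : ℝ))
      ((1 : ℝ →L[ℝ] ℝ).smulRight (EuclideanSpace.single i (1 : ℝ))) t :=
    ((hasFDerivAt_id t).sub_const t₀).smul_const _
  have hγ := (((hψ.mdifferentiable.mdifferentiableAt_symm hmem).hasMFDerivAt.comp t
    hline.hasMFDerivAt).hasMFDerivWithinAt (s := s)).congr_of_eventuallyEq (f₁ := γ)
      (by filter_upwards [self_mem_nhdsWithin] with u hu using hcurve u hu) (hcurve t ht)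
  have hcomp : chartSymmDeriv ψ ((t - t₀) • EuclideanSpace.single i (1 : ℝ)) ∘L
      (1 : ℝ →L[ℝ] ℝ).smulRight (EuclideanSpace.single i (1 : ℝ)) =
      (1 : ℝ →L[ℝ] ℝ).smulRight (show EuclideanSpace ℝ (Fin n) from coordField ψ i (γ t)) := by
    rw [hψ.coordField_eq (hs ht), h t ht]
    ext1
    simp
  exact (congrArg (HasMFDerivWithinAt 𝓘(ℝ, ℝ) (𝓡 n) γ s t) hcomp).mp hγ

end CoordinateLines

section NullCharts

variable {m : ℕ}

lemma apply_eq_null_coordinates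
    {β : EuclideanSpace ℝ (Fin (m + 2)) →L[ℝ] EuclideanSpace ℝ (Fin (m + 2)) →L[ℝ] ℝ}
    (hβ : ∀ v w, β v w = β w v) (hβ₁ : ∀ w, β (EuclideanSpace.single 1 1) w = w 0)
    (v w : EuclideanSpace ℝ (Fin (m + 2))) :
    β v w = (v 0 * w 1 + v 1 * w 0) +
      β (EuclideanSpace.single 0 1) (EuclideanSpace.single 0 1) * v 0 * w 0 +
      ∑ a, β (EuclideanSpace.single (xIdx a) 1) (EuclideanSpace.single 0 1) *
        (v (xIdx a) * w 0 + v 0 * w (xIdx a)) +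
      ∑ a, ∑ b, β (EuclideanSpace.single (xIdx a) 1) (EuclideanSpace.single (xIdx b) 1) *
        v (xIdx a) * w (xIdx b) := by
  have hβ₁' : ∀ v, β v (EuclideanSpace.single 1 1) = v 0 := fun v ↦ by rw [hβ, hβ₁]
  have hu : (EuclideanSpace.single 0 1 : EuclideanSpace ℝ (Fin (m + 2))) 0 = 1 := by simp
  have hx : ∀ a : Fin m,
      (EuclideanSpace.single (xIdx a) 1 : EuclideanSpace ℝ (Fin (m + 2))) 0 = 0 :=
    fun a ↦ by simp [xIdx]
  have hv : (EuclideanSpace.single 1 1 : EuclideanSpace ℝ (Fin (m + 2))) 0 = 0 := by simp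
  have hsum : ∀ f : Fin (m + 2) → ℝ, ∑ i, f i = f 0 + f 1 + ∑ a, f (xIdx a) := fun f ↦ by
    rw [Fin.sum_univ_succ, Fin.sum_univ_succ, ← add_assoc]
    rfl
  rw [apply₂_eq_sum_single]
  simp only [hsum, hβ₁, hβ₁', hu, hv, hx, hβ (EuclideanSpace.single 0 1)
    (EuclideanSpace.single (xIdx _) 1), smul_eq_mul, one_mul, zero_mul, add_zero, mul_add,
    Finset.sum_add_distrib, Finset.sum_const_zero, mul_comm (_ * _) (β _ _), mul_assoc (β _ _)]
  ring

lemma IsLorentzForm.posDef_xBlock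
    {β : EuclideanSpace ℝ (Fin (m + 2)) →L[ℝ] EuclideanSpace ℝ (Fin (m + 2)) →L[ℝ] ℝ}
    (hβ : IsLorentzForm β) (hβ₁ : ∀ w, β (EuclideanSpace.single 1 1) w = w 0) :
    (Matrix.of fun a b : Fin m ↦
      β (EuclideanSpace.single (xIdx a) 1) (EuclideanSpace.single (xIdx b) 1)).PosDef := by
  have hli : LinearIndependent ℝ fun i : Fin (m + 2) ↦
      (EuclideanSpace.single i 1 : EuclideanSpace ℝ (Fin (m + 2))) :=
    EuclideanSpace.orthonormal_single.linearIndependent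
  have hinj : Function.Injective (xIdx (m := m)) :=
    (Fin.succ_injective _).comp (Fin.succ_injective _)
  have hone : (1 : Fin (m + 2)) ∉ range (xIdx (m := m)) := by
    rintro ⟨a, ha⟩
    exact Fin.succ_ne_zero a (Fin.succ_injective _ ha)
  refine hβ.posDef_of_null (k := EuclideanSpace.single 1 1) (by simp [hβ₁])
    (fun a ↦ by simp [hβ₁, xIdx]) (hli.comp xIdx hinj) fun hspan ↦ ?_
  exact hli.notMem_span_image hone (by rwa [← range_comp])

variable {M : Type*} [TopologicalSpace M] [ChartedSpace (EuclideanSpace ℝ (Fin (m + 2))) M]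
  [IsManifold (𝓡 (m + 2)) ∞ M] {g : LorentzianMetric (m + 2) M}

lemma LorentzianMetric.isNullCoordinateChart_of_coordForm
    {ψ : OpenPartialHomeomorph M (EuclideanSpace ℝ (Fin (m + 2)))} (hψ : IsSmoothChart ψ)
    (hdu : ∀ y ∈ ψ.target, ∀ w, g.coordForm ψ y (EuclideanSpace.single 1 1) w = w 0) :
    g.IsNullCoordinateChart ψ := by
  have hlor : ∀ y ∈ ψ.target, IsLorentzForm (g.coordForm ψ y) := fun y hy ↦
    g.isLorentzForm_coordForm hψ hy
  have hsmooth : ∀ v w, ContDiffOn ℝ ∞ (fun y ↦ g.coordForm ψ y v w) ψ.target := fun v w ↦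
    ((g.contDiffOn_coordForm hψ).clm_apply contDiffOn_const).clm_apply contDiffOn_const
  refine ⟨hψ, fun y ↦ g.coordForm ψ y (EuclideanSpace.single 0 1) (EuclideanSpace.single 0 1),
    fun a y ↦ g.coordForm ψ y (EuclideanSpace.single (xIdx a) 1) (EuclideanSpace.single 0 1),
    fun y ↦ Matrix.of fun a b ↦ g.coordForm ψ y (EuclideanSpace.single (xIdx a) 1)
      (EuclideanSpace.single (xIdx b) 1),
    hsmooth _ _, fun _ ↦ hsmooth _ _, fun _ _ ↦ hsmooth _ _,
    fun y hy ↦ (hlor y hy).posDef_xBlock (hdu y hy), fun p hp X Y ↦ ?_⟩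
  exact (g.coordForm_chartDeriv hψ hp X Y).symm.trans
    (apply_eq_null_coordinates (hlor _ (ψ.map_source hp)).symm (hdu _ (ψ.map_source hp)) _ _)

lemma LorentzianMetric.IsNullGeodesicOn.exists_adapted_equiv {γ : ℝ → M} {D : Set ℝ} {t : ℝ}
    (hγ : g.IsNullGeodesicOn γ D) (ht : t ∈ D)
    {φ : OpenPartialHomeomorph M (EuclideanSpace ℝ (Fin (m + 2)))} (hφ : IsSmoothChart φ)
    (htφ : γ t ∈ φ.source) :
    g.coordForm φ (φ (γ t)) (deriv (fun s ↦ φ (γ s)) t) (deriv (fun s ↦ φ (γ s)) t) = 0 ∧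
    ∃ L : EuclideanSpace ℝ (Fin (m + 2)) ≃L[ℝ] EuclideanSpace ℝ (Fin (m + 2)),
      L (EuclideanSpace.single 1 1) = deriv (fun s ↦ φ (γ s)) t ∧
      ∀ w, g.coordForm φ (φ (γ t)) (deriv (fun s ↦ φ (γ s)) t) (L w) = w 0 := by
  rw [← hφ.chartDeriv_velocity
    ((hγ.contMDiffOn.contMDiffAt (hγ.isOpen.mem_nhds ht)).mdifferentiableAt (by simp)) htφ]
  have hnull : g.coordForm φ (φ (γ t)) (chartDeriv φ (γ t) (velocity γ t))
      (chartDeriv φ (γ t) (velocity γ t)) = 0 :=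
    (g.coordForm_chartDeriv hφ htφ _ _).trans (hγ.null t ht)
  have hne : chartDeriv φ (γ t) (velocity γ t) ≠ 0 := fun h ↦ hγ.velocity_ne_zero t ht <| by
    rw [← hφ.chartSymmDeriv_chartDeriv htφ (velocity γ t), h]
    exact map_zero _
  have hmom : g.coordForm φ (φ (γ t)) (chartDeriv φ (γ t) (velocity γ t)) ≠ 0 := fun h ↦
    hne ((g.isLorentzForm_coordForm hφ (φ.map_source htφ)).isInvertible.injective
      (h.trans (map_zero _).symm))
  refine ⟨hnull, exists_equiv_apply_eq_comp_eq rfl hmom (η := EuclideanSpace.proj 0) ?_ hne ?_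
    hnull (by simp)⟩
  · intro h
    simpa using DFunLike.congr_fun h (EuclideanSpace.single 0 1)
  · simp

lemma LorentzianMetric.IsNullGeodesicOn.exists_isNullCoordinateChart {γ : ℝ → M} {D : Set ℝ}
    {t₀ : ℝ} (hγ : g.IsNullGeodesicOn γ D) (ht₀ : t₀ ∈ D) :
    ∃ ψ : OpenPartialHomeomorph M (EuclideanSpace ℝ (Fin (m + 2))), ∃ r > 0,
      g.IsNullCoordinateChart ψ ∧ γ t₀ ∈ ψ.source ∧ ψ.target = Metric.ball 0 r ∧
      ∀ t, |t - t₀| < r → γ t ∈ ψ.source → ψ (γ t) = (t - t₀) • EuclideanSpace.single 1 1 := by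
  set φ := chartAt (EuclideanSpace ℝ (Fin (m + 2))) (γ t₀)
  have hφ : IsSmoothChart φ := IsManifold.chart_mem_maximalAtlas (γ t₀)
  have hp : γ t₀ ∈ φ.source := mem_chart_source _ (γ t₀)
  obtain ⟨hnull, L, hL, hLdu⟩ := hγ.exists_adapted_equiv ht₀ hφ hp
  obtain ⟨e, r, hr, hsource, htarget, he, he', hdu, hline⟩ :=
    exists_local_null_coordinates (τ := EuclideanSpace.proj 1) (e := EuclideanSpace.single 1 1)
      (g.isPseudoRiemannianMetricOn_coordForm hφ) (by simp) (x := fun s ↦ φ (γ s))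
      (v := deriv fun s ↦ φ (γ s)) (φ.map_source hp) hnull
      ((hγ.isOpen_inter_preimage.eventually_mem ⟨ht₀, hp⟩).mono fun t ht ↦
        hγ.hasDerivAt_cogeodesicField hφ ht.1 ht.2) L hL
  have hψ : IsSmoothChart (φ.trans e.symm) := hφ.trans_symm he he'
  have hψtarget : (φ.trans e.symm).target = e.source :=
    inter_eq_left.2 fun y hy ↦ htarget (e.map_source hy)
  have hmem : ∀ t, |t| < r → t • EuclideanSpace.single (1 : Fin (m + 2)) (1 : ℝ) ∈ e.source := by
    simp [hsource, norm_smul]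
  refine ⟨φ.trans e.symm, r, hr, isNullCoordinateChart_of_coordForm hψ fun y hy w ↦ ?_, ⟨hp, ?_⟩,
    hψtarget.trans hsource, fun t ht _ ↦ ?_⟩
  · rw [hψtarget] at hy
    rw [g.coordForm_trans_symm hφ ((he.contDiffAt (e.open_source.mem_nhds hy)).differentiableAt
      (by simp)) (htarget (e.map_source hy)), hdu y hy, hLdu]
  · have h₀ := hmem 0 (by simpa using hr)
    have hline₀ := hline 0 h₀
    rw [add_zero] at hline₀
    change φ (γ t₀) ∈ e.target
    exact hline₀ ▸ e.map_source h₀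
  · have hline_t := hline (t - t₀) (hmem _ ht)
    rw [add_sub_cancel] at hline_t
    change e.symm (φ (γ t)) = _
    rw [← hline_t, e.left_inv (hmem _ ht)]

end NullCharts

theorem theorem4p3_general {m : ℕ} {M : Type*} [TopologicalSpace M]
    [ChartedSpace (EuclideanSpace ℝ (Fin (m + 2))) M] [IsManifold (𝓡 (m + 2)) ∞ M]
    (g : LorentzianMetric (m + 2) M) (γ : ℝ → M) (D : Set ℝ) (hγ : g.IsNullGeodesicOn γ D)
    (t₀ : ℝ) (ht₀ : t₀ ∈ D) :
    ∃ ψ : OpenPartialHomeomorph M (EuclideanSpace ℝ (Fin (m + 2))),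
      g.IsNullCoordinateChart ψ ∧ γ t₀ ∈ ψ.source ∧ ψ (γ t₀) = 0 ∧
      IsMIntegralCurveOn γ (fun p ↦ coordField ψ 1 p)
        {t | t ∈ D ∧ γ '' uIcc t₀ t ⊆ ψ.source} := by
  obtain ⟨ψ, r, hr, hψ, hp, htarget, hline⟩ := hγ.exists_isNullCoordinateChart ht₀
  refine ⟨ψ, hψ, hp, by simpa using hline t₀ (by simpa using hr) hp,
    hψ.1.isMIntegralCurveOn_coordField (t₀ := t₀)
      (fun t ht ↦ ht.2 (mem_image_of_mem γ right_mem_uIcc)) fun t ht ↦ ?_⟩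
  exact chart_comp_eq_smul_of_image_uIcc_subset
    (hγ.contMDiffOn.continuousOn.mono (hγ.ordConnected.uIcc_subset ht₀ ht.1)) ht.2 hr (by simp)
    htarget.subset hline

end

theorem theorem4p3 {m : ℕ} {M : Type*} [TopologicalSpace M]
    [ChartedSpace (EuclideanSpace ℝ (Fin (m + 2))) M] [IsManifold (𝓡 (m + 2)) ∞ M]
    (g : LorentzianMetric (m + 2) M) (γ : ℝ → M) (D J : Set ℝ)
    (hγ : g.IsNullGeodesicOn γ D) (hJ : g.IsConjugatePointFreePortion γ D J)
    (t₀ : ℝ) (ht₀ : t₀ ∈ J) :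
    ∃ ψ : OpenPartialHomeomorph M (EuclideanSpace ℝ (Fin (m + 2))),
      g.IsNullCoordinateChart ψ ∧ γ t₀ ∈ ψ.source ∧ ψ (γ t₀) = 0 ∧
      IsMIntegralCurveOn γ (fun p ↦ coordField ψ 1 p)
        {t | t ∈ D ∧ γ '' uIcc t₀ t ⊆ ψ.source} := by
  exact theorem4p3_general g γ D hγ t₀ (hJ.subset ht₀)
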